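/- Let $p$ be a prime and let $0<\alpha,q<1$ be real numbers. For $n\ge 0$ let $G(n,\alpha,q)$ be the random bipartite graph with sides $L$, $R$ of sizes $|L|=n$, $|R|=\lfloor\alpha n\rfloor$, in which each pair $(v,u)\in L\times R$ is an edge independently with probability $q$. For a connected finite graph $H$ with laplacian $\Delta=D-A$, the sandpile group $\Gamma(H)$ is the cokernel over $\mathbb Z$ of the reduced laplacian, obtained from $\Delta$ by deleting the row and the column of one vertex; for a disconnected graph, $\Gamma(H)$ is the direct sum of the sandpile groups of its connected components. The $p$-rank of a finite abelian group $\Gamma$ is $\dim_{\mathbb Z/p\mathbb Z}(\Gamma\otimes\mathbb Z/p\mathbb Z)$. Let $B(n,1/p)$ denote the binomial distribution with parameters $n$ and $1/p$. Then the $p$-rank of $\Gamma(G(n,\alpha,q))$ is usually within small distance of $\max\left(B\left(n,\tfrac1p\right)-\alpha n,\,0\right)$. That is, there is a probability space $(\Omega,\mathbb P)$ carrying, for every $n$, a random graph $G_n$ distributed as $G(n,\alpha,q)$ and a random variable $B_n$ distributed as $B(n,1/p)$, such that, with $X_n$ the $p$-rank of $\Gamma(G_n)$ and $Y_n=\max(B_n-\alpha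 n,0)$, there exist constants $c,K>0$ (depending only on $p,\alpha,q$) with $$\mathbb P\left(|X_n-Y_n|\ge m\right)\le K e^{-cm}\qquad\text{for every integer } n\ge 1 \text{ and every real } m>0 .$$ -/

import Mathlib

open MeasureTheory ProbabilityTheory
open scoped TensorProduct DirectSum

noncomputable section

/-! ### Sandpile groups and `p`-ranks -/

open Classical in
/-- The laplacian `D - A` of `G` with the row and the column of the vertex `v` removed. -/
def reducedLaplacian {V : Type*} [Fintype V] (G : SimpleGraph V) (v : V) :
    Matrix {w : V // w ≠ v} {w : V // w ≠ v} ℤ :=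
  (G.lapMatrix ℤ).submatrix Subtype.val Subtype.val

open Classical in
/-- The cokernel of the reduced laplacian at `v`: for connected `G`, the sandpile group of `G`. -/
abbrev ReducedLaplacianCokernel {V : Type*} [Fintype V] (G : SimpleGraph V) (v : V) : Type _ :=
  ({w : V // w ≠ v} → ℤ) ⧸
    LinearMap.range (Matrix.mulVecLin (reducedLaplacian G v))

/-- A chosen vertex of a connected component. -/
def SimpleGraph.ConnectedComponent.root {V : Type*} {G : SimpleGraph V}
    (C : G.ConnectedComponent) : C :=
  ⟨C.nonempty_supp.some, C.nonempty_supp.some_mem⟩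

open Classical in
/-- The sandpile group of a finite graph: the direct sum, over its connected components, of the
cokernels of their reduced laplacians. -/
abbrev SandpileGroup {V : Type*} [Fintype V] (G : SimpleGraph V) : Type _ :=
  ⨁ C : G.ConnectedComponent, ReducedLaplacianCokernel C.toSimpleGraph C.root

/-- The `p`-rank of an abelian group `A`: the dimension over `ℤ/pℤ` of `A ⊗ ℤ/pℤ = A/pA`
(for a finite abelian group this is the rank of its `p`-part). -/
def pRank (p : ℕ) [Fact p.Prime] (A : Type*) [AddCommGroup A] : ℕ :=
  Module.finrank (ZMod p) (ZMod p ⊗[ℤ] A)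

/-! ### Random bipartite graphs -/

/-- The bipartite graph with sides `L` and `R` whose set of edges is `E`. -/
def bipartiteGraph {L R : Type*} (E : Set (L × R)) : SimpleGraph (L ⊕ R) :=
  SimpleGraph.fromRel fun x y ↦ ∃ e ∈ E, x = Sum.inl e.1 ∧ y = Sum.inr e.2

/-- The law of the random bipartite graph `G(n, α, q)`, with sides of sizes `n` and `⌊α n⌋`:
each pair of `L × R` is an edge independently with probability `q`. -/
def randomBipartiteLaw (n : ℕ) (α : ℝ) (q : unitInterval) :
    Measure (SimpleGraph (Fin n ⊕ Fin ⌊α * n⌋₊)) :=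
  (setBernoulli (Set.univ : Set (Fin n × Fin ⌊α * n⌋₊)) q).map bipartiteGraph

/-- The number `1 / p` as an element of the unit interval. -/
def oneDivNat (p : ℕ) : unitInterval :=
  ⟨1 / (p : ℝ), by positivity, by
    rcases Nat.eq_zero_or_pos p with rfl | hp
    · simp
    · exact (div_le_one (by positivity)).2 (by exact_mod_cast hp)⟩

/-! ### Closeness of random variables -/

/-- The sequences `X n` and `Y n` of real random variables are usually within small distance. -/
def UsuallyWithinSmallDistance {Ω : Type*} [MeasurableSpace Ω] (μ : Measure Ω)
    (X Y : ℕ → Ω → ℝ) : Prop :=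
  ∃ c > (0 : ℝ), ∃ K > (0 : ℝ), ∀ n : ℕ, 0 < n → ∀ m : ℝ, 0 < m →
    μ.real {ω | m ≤ |X n ω - Y n ω|} ≤ K * Real.exp (-(c * m))

end

/-!
The argument compares the `p`-rank of the sandpile group with the corank of the laplacian mod `p`,
and bounds the latter from both sides, conditionally on the degrees mod `p` of the vertices of
`L`.

*From the sandpile group to the laplacian.* Tensoring with `ZMod p`, the `p`-rank of the sandpile
group is the sum over the components of the coranks of the reduced laplacians mod `p`. It differs
from the corank of the laplacian mod `p` by at most the number of components
(`pRank_sandpileGroup_le`, `finrank_lapKer_le`), and the random graph is connected up to an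
exponentially small probability (`sum_matWeight_disconnected_le`).

*Lower bound.* If `Z` vertices of `L` have degree zero mod `p`, their rows in the laplacian are
supported on the columns of `R`, so the corank is at least `Z - |R|` (`card_rowDeg_eq_zero_le`).

*Upper bound.* By Markov's inequality it is enough to bound the first moment of the size
`p ^ corank` of the kernel, given the vector `d` of degrees, by a constant times `p ^ max (Z - |R|, 0)`
(`sum_matWeight_mul_pow_finrank_le`). Orthogonality of characters writes the size of the kernel as
a sum over pairs of vectors on `L ∪ R`. For fixed values `h : R → ZMod p × ZMod p` on `R`, the sum
over the values on `L` and over the random edges factors over the vertices `v` of `L`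
(`sum_pow_finrank_lapKer`), and the factor `vertexSum` of `v` is governed by the hyperbolas
`(k₁ - z₁) (k₂ - z₂) = t` which contain almost all of the points `h u`: each of them contributes at most
`1 / p`, with a gain as soon as a point is missed, and the others contribute a negligible amount
(`card_mul_norm_vertexSum_le`). When the degree is not zero mod `p`, a Gauss sum gives a better
bound (`norm_sum_stdAddChar_hyp_le`). Two hyperbolas with different centres meet in at most `p`
points. So either there is at most one such hyperbola, or `h` takes almost all of its values in a
set of at most `p` points, or `h` is almost constant, in which case there can be as many as `p²`
of them (`vertexSum_cases`). Counting the `h` of each kind, with the gains compensating for the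
exceptional values, gives `sum_prod_norm_vertexSum_le`. Up to the common factor `p ^ (|L| + |R|)`,
the constant and almost constant `h` contribute `p ^ max (Z - |R|, 0)`, and the other `h`
contribute a bounded amount because `|R| ≤ |L|`.

*Coupling.* The degrees mod `p` of the vertices of `L` are independent and exponentially close to
uniform (`sum_abs_prod_rowProb_sub_le`). They can be coupled with a uniform vector from which they
differ with exponentially small probability (`exists_coupling`), and the number of zeros of a
uniform vector has the binomial law `B(n, 1/p)`. As the distance is at most `2 n` in any case,
bounds that are exponentially small in `n` suffice for the exceptional events
(`exists_tail_bound`).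
-/

/-! ### The `p`-rank of a sandpile group and the kernel of the laplacian mod `p` -/

/-- The `p`-rank of the cokernel of an integer matrix is the corank of the matrix mod `p`. -/
lemma pRank_quotient_range_mulVecLin (p : ℕ) [Fact p.Prime] {m : Type*} [Fintype m]
    (N : Matrix m m ℤ) :
    pRank p ((m → ℤ) ⧸ LinearMap.range N.mulVecLin) =
      Module.finrank (ZMod p)
        (LinearMap.ker (N.map (Int.cast : ℤ → ZMod p)).mulVecLin) := by
  classical
  set f : (m → ℤ) →ₗ[ℤ] (m → ℤ) := N.mulVecLin
  set g := (LinearMap.range f).mkQ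
  have hex := lTensor_exact (ZMod p) (f := f) (g := g) (LinearMap.exact_map_mkQ_range f)
    (Submodule.mkQ_surjective _)
  have hker : LinearMap.ker (g.baseChange (ZMod p)) = LinearMap.range (f.baseChange (ZMod p)) := by
    ext x
    exact hex x
  have hsurj : LinearMap.range (g.baseChange (ZMod p)) = ⊤ :=
    LinearMap.range_eq_top.2 (LinearMap.lTensor_surjective _ (Submodule.mkQ_surjective _))
  have h1 := LinearMap.finrank_range_add_finrank_ker (g.baseChange (ZMod p))
  have h2 := LinearMap.finrank_range_add_finrank_ker (f.baseChange (ZMod p))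
  rw [hsurj, finrank_top, hker] at h1
  have h3 := LinearMap.finrank_range_add_finrank_ker (N.map (Int.cast : ℤ → ZMod p)).mulVecLin
  have h4 : Module.finrank (ZMod p) (LinearMap.range (f.baseChange (ZMod p))) =
      (N.map (Int.cast : ℤ → ZMod p)).rank := by
    have := LinearMap.toMatrix_baseChange (ZMod p) f (Pi.basisFun ℤ m) (Pi.basisFun ℤ m)
    have hN : (LinearMap.toMatrix (Pi.basisFun ℤ m) (Pi.basisFun ℤ m)) f = N := by
      rw [LinearMap.toMatrix_eq_toMatrix']
      exact LinearMap.toMatrix'_toLin' N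
    rw [hN] at this
    have h5 := Matrix.rank_eq_finrank_range_toLin ((N.map (Int.cast : ℤ → ZMod p)))
      (Algebra.TensorProduct.basis (ZMod p) (Pi.basisFun ℤ m))
      (Algebra.TensorProduct.basis (ZMod p) (Pi.basisFun ℤ m))
    have h6 : (N.map (Int.cast : ℤ → ZMod p)) = N.map (algebraMap ℤ (ZMod p)) := rfl
    rw [h5, h6, ← this, Matrix.toLin_toMatrix]
  have h7 : Module.finrank (ZMod p) (ZMod p ⊗[ℤ] (m → ℤ)) = Fintype.card m := by
    rw [Module.finrank_baseChange, Module.finrank_fintype_fun_eq_card]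
  have h8 : Module.finrank (ZMod p) (m → ZMod p) = Fintype.card m :=
    Module.finrank_fintype_fun_eq_card _
  unfold pRank
  rw [Matrix.rank] at h4
  omega

lemma pRank_directSum (p : ℕ) [Fact p.Prime] {ι : Type*} [Fintype ι] [DecidableEq ι]
    (A : ι → Type*) [∀ i, AddCommGroup (A i)] [∀ i, Module.Finite ℤ (A i)] :
    pRank p (⨁ i, A i) = ∑ i, pRank p (A i) := by
  unfold pRank
  rw [(TensorProduct.directSumRight ℤ (ZMod p) (ZMod p) A).finrank_eq, Module.finrank_directSum]

open Classical in
/-- The value at `v` of the laplacian of `G` applied to `x`. -/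
noncomputable def SimpleGraph.lapAt {V F : Type*} [Fintype V] [AddCommGroup F] (G : SimpleGraph V)
    (x : V → F) (v : V) : F :=
  ∑ w, if G.Adj v w then x v - x w else 0

open Classical in
lemma SimpleGraph.lapMatrix_mulVec_eq_lapAt {V F : Type*} [Fintype V] [Ring F]
    (G : SimpleGraph V) (x : V → F) (v : V) : (G.lapMatrix F).mulVec x v = G.lapAt x v := by
  rw [G.lapMatrix_mulVec_apply, lapAt, G.degree_eq_sum_if_adj, Finset.sum_mul,
    SimpleGraph.neighborFinset_eq_filter, Finset.sum_filter, ← Finset.sum_sub_distrib]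
  refine Finset.sum_congr rfl fun w _ ↦ ?_
  split_ifs <;> simp

lemma SimpleGraph.sum_lapAt {V F : Type*} [Fintype V] [AddCommGroup F]
    (G : SimpleGraph V) (x : V → F) : ∑ v, G.lapAt x v = 0 := by
  classical
  have h : ∑ v, G.lapAt x v = (∑ v, ∑ w, if G.Adj v w then x v else 0) -
      ∑ v, ∑ w, if G.Adj v w then x w else 0 := by
    simp only [lapAt, ← Finset.sum_sub_distrib]
    refine Finset.sum_congr rfl fun v _ ↦ Finset.sum_congr rfl fun w _ ↦ ?_
    split_ifs <;> simp
  rw [h, sub_eq_zero, Finset.sum_comm]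
  simp only [G.adj_comm]

lemma SimpleGraph.lapAt_sub_const {V F : Type*} [Fintype V] [AddCommGroup F]
    (G : SimpleGraph V) (x : V → F) (c : F) (v : V) :
    G.lapAt (fun w ↦ x w - c) v = G.lapAt x v := by
  simp [lapAt]

lemma SimpleGraph.lapAt_component {V F : Type*} [Fintype V] [AddCommGroup F]
    (G : SimpleGraph V) (C : G.ConnectedComponent) [Fintype C] (x : V → F) (v : C) :
    C.toSimpleGraph.lapAt (fun w : C ↦ x w) v = G.lapAt x v := by
  classical
  have hout : ∀ w, w ∉ C → (if G.Adj v w then x v - x w else 0) = 0 := fun w hw ↦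
    if_neg fun h ↦ hw (C.mem_supp_of_adj_mem_supp v.2 h)
  have h := Finset.sum_subtype (p := fun w ↦ w ∈ C) (F := inferInstance)
    (Finset.univ.filter fun w ↦ w ∈ C) (by simp)
    (fun w ↦ if G.Adj v w then x v - x w else 0)
  rw [Finset.sum_filter_of_ne (fun w _ hw ↦ not_imp_comm.1 (hout w) hw)] at h
  rw [lapAt, lapAt, h]
  rfl

/-- The kernel of the laplacian of `G` mod `p`. -/
def SimpleGraph.lapKer (p : ℕ) {V : Type*} [Fintype V] (G : SimpleGraph V) :
    Submodule (ZMod p) (V → ZMod p) where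
  carrier := {x | ∀ v, G.lapAt x v = 0}
  add_mem' {x y} hx hy v := by
    have : G.lapAt (x + y) v = G.lapAt x v + G.lapAt y v := by
      simp only [lapAt, ← Finset.sum_add_distrib]
      refine Finset.sum_congr rfl fun w _ ↦ ?_
      split_ifs <;> simp [add_sub_add_comm]
    rw [this, hx v, hy v, add_zero]
  zero_mem' v := by simp [lapAt]
  smul_mem' c x hx v := by
    have : G.lapAt (c • x) v = c * G.lapAt x v := by
      simp only [lapAt, Finset.mul_sum]
      refine Finset.sum_congr rfl fun w _ ↦ ?_
      split_ifs <;> simp [mul_sub]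
    rw [this, hx v, mul_zero]

lemma SimpleGraph.mem_lapKer {p : ℕ} {V : Type*} [Fintype V] {G : SimpleGraph V}
    {x : V → ZMod p} : x ∈ G.lapKer p ↔ ∀ v, G.lapAt x v = 0 := Iff.rfl

/-- The kernel of the reduced laplacian consists of the elements of the kernel of the laplacian
that vanish at the deleted vertex. -/
lemma mem_ker_reducedLaplacian_iff {p : ℕ} {V : Type*} [Fintype V] {G : SimpleGraph V}
    (v : V) [Fintype {w : V // w ≠ v}] {x : V → ZMod p} (hx : x v = 0) :
    (fun w : {w : V // w ≠ v} ↦ x w) ∈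
      LinearMap.ker ((reducedLaplacian G v).map (Int.cast : ℤ → ZMod p)).mulVecLin ↔
    x ∈ G.lapKer p := by
  classical
  have key : ∀ w : {w : V // w ≠ v},
      (((reducedLaplacian G v).map (Int.cast : ℤ → ZMod p)).mulVec
        fun w : {w : V // w ≠ v} ↦ x w) w = G.lapAt x w := by
    intro w
    rw [← SimpleGraph.lapMatrix_mulVec_eq_lapAt]
    simp only [Matrix.mulVec, dotProduct]
    rw [← Finset.sum_erase (Finset.univ) (a := v) (by rw [hx, mul_zero])]
    rw [Finset.sum_subtype (p := fun w ↦ w ≠ v) (F := inferInstance) (Finset.univ.erase v)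
      (by simp)]
    refine Finset.sum_congr rfl fun u _ ↦ ?_
    congr 1
    simp only [reducedLaplacian, Matrix.map_apply, Matrix.submatrix_apply, SimpleGraph.lapMatrix,
      SimpleGraph.degMatrix, Matrix.sub_apply, SimpleGraph.adjMatrix_apply, Matrix.diagonal_apply]
    push_cast
    congr
  rw [LinearMap.mem_ker, Matrix.mulVecLin_apply, funext_iff, SimpleGraph.mem_lapKer]
  simp only [key, Pi.zero_apply]
  refine ⟨fun h w ↦ ?_, fun h w ↦ h w⟩
  by_cases hw : w = v
  · subst hw
    rw [← G.sum_lapAt x, eq_comm]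
    exact Finset.sum_eq_single w (fun u _ hu ↦ h ⟨u, hu⟩) (by simp)
  · exact h ⟨w, hw⟩

open Classical in
/-- The kernels, over the connected components `C`, of the reduced laplacians of `C` mod `p`. -/
abbrev ReducedKernels (p : ℕ) {V : Type*} [Fintype V] (G : SimpleGraph V) : Type _ :=
  (C : G.ConnectedComponent) →
    LinearMap.ker ((reducedLaplacian C.toSimpleGraph C.root).map (Int.cast : ℤ → ZMod p)).mulVecLin

open Classical in
lemma pRank_reducedLaplacianCokernel (p : ℕ) [Fact p.Prime] {V : Type*} [Fintype V]
    (G : SimpleGraph V) (v : V) :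
    pRank p (ReducedLaplacianCokernel G v) = Module.finrank (ZMod p)
      (LinearMap.ker ((reducedLaplacian G v).map (Int.cast : ℤ → ZMod p)).mulVecLin) :=
  pRank_quotient_range_mulVecLin p _

open Classical in
lemma pRank_sandpileGroup (p : ℕ) [Fact p.Prime] {V : Type*} [Fintype V] (G : SimpleGraph V) :
    pRank p (SandpileGroup G) = Module.finrank (ZMod p) (ReducedKernels p G) := by
  have h1 : pRank p (SandpileGroup G) =
      ∑ C : G.ConnectedComponent, pRank p (ReducedLaplacianCokernel C.toSimpleGraph C.root) :=
    pRank_directSum p _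
  have h2 : Module.finrank (ZMod p) (ReducedKernels p G) =
      ∑ C : G.ConnectedComponent, Module.finrank (ZMod p) (LinearMap.ker
        ((reducedLaplacian C.toSimpleGraph C.root).map (Int.cast : ℤ → ZMod p)).mulVecLin) :=
    Module.finrank_pi_fintype _
  rw [h1, h2]
  refine Finset.sum_congr rfl fun C _ ↦
    (pRank_reducedLaplacianCokernel p C.toSimpleGraph C.root).trans ?_
  congr!

open Classical in
/-- Extending by zero at the roots of the components identifies the product of the kernels of the
reduced laplacians with a subspace of the kernel of the laplacian. -/
lemma pRank_sandpileGroup_le (p : ℕ) [Fact p.Prime] {V : Type*} [Fintype V] (G : SimpleGraph V) :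
    pRank p (SandpileGroup G) ≤ Module.finrank (ZMod p) (G.lapKer p) := by
  rw [pRank_sandpileGroup]
  let e (C : G.ConnectedComponent) (y : {w : C // w ≠ C.root} → ZMod p) (w : C) : ZMod p :=
    if h : w = C.root then 0 else y ⟨w, h⟩
  let E : ReducedKernels p G →ₗ[ZMod p] (V → ZMod p) :=
    { toFun := fun y v ↦ e (G.connectedComponentMk v) (y _).1 ⟨v, rfl⟩
      map_add' := by
        intro x y
        ext v
        simp only [e, Pi.add_apply, Submodule.coe_add]
        split_ifs <;> simp
      map_smul' := by
        intro c x
        ext v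
        simp only [e, Pi.smul_apply, SetLike.val_smul]
        split_ifs <;> simp }
  have hE : ∀ y (C : G.ConnectedComponent) (w : C), E y w = e C (y C).1 w := by
    rintro y C ⟨w, rfl⟩
    rfl
  have hmem : ∀ y, E y ∈ G.lapKer p := by
    intro y v
    set C := G.connectedComponentMk v
    have h0 : (fun w : C ↦ E y w) C.root = 0 := by simp [hE, e]
    have := (mem_ker_reducedLaplacian_iff (G := C.toSimpleGraph) C.root
      (x := fun w : C ↦ E y w) h0).1 (by
      convert (y C).2 using 1
      ext w
      simp [hE, e, w.2])
    rw [← this ⟨v, rfl⟩, G.lapAt_component C (E y)]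
  refine LinearMap.finrank_le_finrank_of_injective (f := E.codRestrict _ hmem) ?_
  intro x y hxy
  funext C
  ext w
  have h1 : E x w = E y w := congrFun (congrArg Subtype.val hxy) w
  rw [hE, hE] at h1
  simpa [e, w.2] using h1

open Classical in
/-- An element of the kernel of the laplacian is determined by its values at the roots of the
components and by its differences to them. -/
lemma finrank_lapKer_le (p : ℕ) [Fact p.Prime] {V : Type*} [Fintype V] (G : SimpleGraph V) :
    Module.finrank (ZMod p) (G.lapKer p) ≤
      pRank p (SandpileGroup G) + Nat.card G.ConnectedComponent := by
  rw [pRank_sandpileGroup, Nat.card_eq_fintype_card]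
  have hmem : ∀ (x : G.lapKer p) (C : G.ConnectedComponent),
      (fun w : {w : C // w ≠ C.root} ↦ x.1 w - x.1 C.root) ∈ LinearMap.ker
        ((reducedLaplacian C.toSimpleGraph C.root).map (Int.cast : ℤ → ZMod p)).mulVecLin := by
    intro x C
    refine (mem_ker_reducedLaplacian_iff (G := C.toSimpleGraph) C.root
      (x := fun w : C ↦ x.1 w - x.1 C.root) (sub_self _)).2 fun v ↦ ?_
    rw [C.toSimpleGraph.lapAt_sub_const, G.lapAt_component C x.1]
    exact x.2 v
  let T : G.lapKer p →ₗ[ZMod p] ReducedKernels p G × (G.ConnectedComponent → ZMod p) :=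
    { toFun := fun x ↦ (fun C ↦ ⟨_, hmem x C⟩, fun C ↦ x.1 C.root)
      map_add' := by
        intro x y
        refine Prod.ext ?_ ?_
        · funext C
          ext w
          simp [add_sub_add_comm]
        · funext C
          simp
      map_smul' := by
        intro c x
        refine Prod.ext ?_ ?_
        · funext C
          ext w
          simp [mul_sub]
        · funext C
          simp }
  have hT : Function.Injective T := by
    intro x y hxy
    ext v
    set C := G.connectedComponentMk v
    have h1 : x.1 C.root = y.1 C.root := congrFun (congrArg Prod.snd hxy) C
    by_cases hv : (⟨v, rfl⟩ : C) = C.root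
    · rw [← hv] at h1
      exact h1
    · have h2 : x.1 v - x.1 C.root = y.1 v - y.1 C.root :=
        congrFun (congrArg Subtype.val (congrFun (congrArg Prod.fst hxy) C)) ⟨⟨v, rfl⟩, hv⟩
      rw [h1] at h2
      exact sub_left_injective h2
  have := LinearMap.finrank_le_finrank_of_injective hT
  rwa [Module.finrank_prod, Module.finrank_fintype_fun_eq_card] at this

/-! ### Bipartite graphs given by `0`-`1` matrices -/

/-- The bipartite graph with biadjacency matrix `M`. -/
def matrixGraph {L R : Type*} (M : L → R → Bool) : SimpleGraph (L ⊕ R) :=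
  bipartiteGraph {e | M e.1 e.2 = true}

section matrixGraph

variable {L R : Type*} {M : L → R → Bool}

lemma matrixGraph_adj_inl_inr {v : L} {u : R} :
    (matrixGraph M).Adj (Sum.inl v) (Sum.inr u) ↔ M v u = true := by
  simp [matrixGraph, bipartiteGraph]

lemma matrixGraph_adj_inr_inl {v : L} {u : R} :
    (matrixGraph M).Adj (Sum.inr u) (Sum.inl v) ↔ M v u = true := by
  rw [SimpleGraph.adj_comm, matrixGraph_adj_inl_inr]

lemma not_matrixGraph_adj_inl_inl {v w : L} :
    ¬ (matrixGraph M).Adj (Sum.inl v) (Sum.inl w) := by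
  simp [matrixGraph, bipartiteGraph]

lemma not_matrixGraph_adj_inr_inr {v w : R} :
    ¬ (matrixGraph M).Adj (Sum.inr v) (Sum.inr w) := by
  simp [matrixGraph, bipartiteGraph]

lemma lapAt_matrixGraph_inl [Fintype L] [Fintype R] {F : Type*} [AddCommGroup F] (x : L ⊕ R → F)
    (v : L) : (matrixGraph M).lapAt x (Sum.inl v) =
      ∑ u, if M v u then x (Sum.inl v) - x (Sum.inr u) else 0 := by
  simp [SimpleGraph.lapAt, Fintype.sum_sum_type, matrixGraph_adj_inl_inr,
    not_matrixGraph_adj_inl_inl]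

lemma lapAt_matrixGraph_inr [Fintype L] [Fintype R] {F : Type*} [AddCommGroup F] (x : L ⊕ R → F)
    (u : R) : (matrixGraph M).lapAt x (Sum.inr u) =
      ∑ v, if M v u then x (Sum.inr u) - x (Sum.inl v) else 0 := by
  simp [SimpleGraph.lapAt, Fintype.sum_sum_type, matrixGraph_adj_inr_inl,
    not_matrixGraph_adj_inr_inr]

/-- The sum mod `p` of a `0`-`1` vector. -/
def rowDeg (p : ℕ) {R : Type*} [Fintype R] (m : R → Bool) : ZMod p :=
  ∑ u, if m u then 1 else 0

lemma finrank_lapKer_matrixGraph_le (p : ℕ) [Fact p.Prime] [Fintype L] [Fintype R]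
    (M : L → R → Bool) :
    Module.finrank (ZMod p) ((matrixGraph M).lapKer p) ≤ Fintype.card L + Fintype.card R := by
  refine (Submodule.finrank_le _).trans ?_
  rw [Module.finrank_fintype_fun_eq_card, Fintype.card_sum]

/-- The vertices of `L` whose degree is zero mod `p` give rows of the laplacian supported on the
columns of `R`, so the laplacian has corank at least their number minus `|R|`. -/
lemma card_rowDeg_eq_zero_le (p : ℕ) [Fact p.Prime] [Fintype L] [Fintype R]
    (M : L → R → Bool) :
    (Finset.univ.filter fun v ↦ rowDeg p (M v) = 0).card ≤
      Module.finrank (ZMod p) ((matrixGraph M).lapKer p) + Fintype.card R := by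
  classical
  set S := Finset.univ.filter fun v ↦ rowDeg p (M v) = 0
  let T : (S → ZMod p) →ₗ[ZMod p] (R → ZMod p) :=
    { toFun := fun f u ↦ ∑ v : S, if M v u then f v else 0
      map_add' := by
        intro f g
        ext u
        simp only [Pi.add_apply, ← Finset.sum_add_distrib]
        refine Finset.sum_congr rfl fun v _ ↦ ?_
        split_ifs <;> simp
      map_smul' := by
        intro c f
        ext u
        simp [Finset.mul_sum] }
  let ext : (S → ZMod p) →ₗ[ZMod p] (L ⊕ R → ZMod p) :=
    { toFun := fun f ↦ Sum.elim (fun v ↦ if h : v ∈ S then f ⟨v, h⟩ else 0) 0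
      map_add' := by
        intro f g
        ext (v | u)
        · simp only [Sum.elim_inl, Pi.add_apply]
          split_ifs <;> simp
        · simp
      map_smul' := by
        intro c f
        ext (v | u)
        · simp
        · simp }
  have hmem : ∀ f : LinearMap.ker T, ext f ∈ (matrixGraph M).lapKer p := by
    rintro ⟨f, hf⟩ (v | u)
    · rw [lapAt_matrixGraph_inl]
      simp only [ext, LinearMap.coe_mk, AddHom.coe_mk, Sum.elim_inl, Sum.elim_inr,
        Pi.zero_apply, sub_zero]
      split_ifs with h
      · have h0 : rowDeg p (M v) = 0 := (Finset.mem_filter.1 h).2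
        have : ∑ u, (if M v u then f ⟨v, h⟩ else 0) = rowDeg p (M v) * f ⟨v, h⟩ := by
          rw [rowDeg, Finset.sum_mul]
          simp only [ite_mul, one_mul, zero_mul]
        rw [this, h0, zero_mul]
      · simp
    · rw [lapAt_matrixGraph_inr]
      have h0 : ∑ v : S, (if M v u then f v else 0) = 0 := congrFun hf u
      simp only [ext, LinearMap.coe_mk, AddHom.coe_mk, Sum.elim_inl, Sum.elim_inr,
        Pi.zero_apply, zero_sub]
      have h1 : ∑ v : L, (if M v u then (if h : v ∈ S then f ⟨v, h⟩ else 0) else 0) =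
          ∑ v : S, (if M v u then f v else 0) := by
        rw [← Finset.sum_subset (Finset.subset_univ S), ← Finset.sum_coe_sort S]
        · refine Finset.sum_congr rfl fun v _ ↦ ?_
          simp
        · intro v _ hv
          simp [hv]
      rw [h0] at h1
      refine Eq.trans ?_ (neg_eq_zero.2 h1)
      rw [← Finset.sum_neg_distrib]
      refine Finset.sum_congr rfl fun v _ ↦ ?_
      split_ifs <;> simp
  have hinj : Function.Injective ((ext.domRestrict (LinearMap.ker T)).codRestrict _ hmem) := by
    intro f g hfg
    ext v
    have h1 : ext f.1 (Sum.inl v) = ext g.1 (Sum.inl v) :=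
      congrFun (congrArg Subtype.val hfg) (Sum.inl v)
    simpa [ext] using h1
  have h1 := LinearMap.finrank_le_finrank_of_injective hinj
  have h2 := LinearMap.finrank_range_add_finrank_ker T
  have h3 := Submodule.finrank_le (LinearMap.range T)
  rw [Module.finrank_fintype_fun_eq_card] at h2 h3
  rw [Fintype.card_coe] at h2
  omega

/-- A bipartite graph is connected as soon as any two vertices of `L` have a common neighbour and
every vertex of `R` has a neighbour. -/
lemma card_connectedComponent_matrixGraph_le_one
    (h1 : ∀ v w, v ≠ w → ∃ u, M v u = true ∧ M w u = true) (h2 : ∀ u, ∃ v, M v u = true) :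
    Nat.card (matrixGraph M).ConnectedComponent ≤ 1 := by
  have hL : ∀ v w : L, (matrixGraph M).Reachable (Sum.inl v) (Sum.inl w) := by
    intro v w
    by_cases hvw : v = w
    · rw [hvw]
    · obtain ⟨u, hv, hw⟩ := h1 v w hvw
      exact (matrixGraph_adj_inl_inr.2 hv).reachable.trans (matrixGraph_adj_inr_inl.2 hw).reachable
  have hR : ∀ x : L ⊕ R, ∃ v : L, (matrixGraph M).Reachable x (Sum.inl v) := by
    rintro (v | u)
    · exact ⟨v, SimpleGraph.Reachable.refl _⟩
    · obtain ⟨v, hv⟩ := h2 u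
      exact ⟨v, (matrixGraph_adj_inr_inl.2 hv).reachable⟩
  have hpre : (matrixGraph M).Preconnected := fun x y ↦ by
    obtain ⟨v, hv⟩ := hR x
    obtain ⟨w, hw⟩ := hR y
    exact hv.trans ((hL v w).trans hw.symm)
  have := hpre.subsingleton_connectedComponent
  exact Finite.card_le_one_iff_subsingleton.2 this

end matrixGraph

/-! ### Counting the kernel with characters -/

/-- The probability of the `0`-`1` vector `m` when the entries are independent and equal to `1`
with probability `q`. -/
def rowWeight {R : Type*} [Fintype R] (q : ℝ) (m : R → Bool) : ℝ :=
  ∏ u, if m u then q else 1 - q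

/-- The hyperbola form `(k₁ - z₁) (k₂ - z₂)` on the plane over `ZMod p`. -/
def hyp {p : ℕ} (k z : ZMod p × ZMod p) : ZMod p := (k.1 - z.1) * (k.2 - z.2)

/-- The pair `(k, t)` stands for the hyperbola `hyp k z = t` with centre `k`. -/
abbrev Hyperbola (p : ℕ) : Type := (ZMod p × ZMod p) × ZMod p

/-- The contribution of a vertex of `L` with degree `e` mod `p` to the expected size of the kernel
of the laplacian, once the values `h` on `R` of a vector and of a character are fixed. -/
noncomputable def vertexSum (p : ℕ) [NeZero p] {R : Type*} [Fintype R] [DecidableEq R] (q : ℝ)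
    (e : ZMod p) (h : R → ZMod p × ZMod p) : ℂ :=
  ∑ m : R → Bool, (rowWeight q m : ℂ) * (if rowDeg p m = e then 1 else 0) *
    ∑ k : ZMod p × ZMod p, ZMod.stdAddChar (∑ u, if m u then hyp k (h u) else 0)

lemma stdAddChar_sum {p : ℕ} [NeZero p] {ι : Type*} (s : Finset ι) (f : ι → ZMod p) :
    ZMod.stdAddChar (∑ i ∈ s, f i) = ∏ i ∈ s, ZMod.stdAddChar (f i) := by
  classical
  induction s using Finset.induction_on with
  | empty => simp
  | insert i s hi ih => rw [Finset.sum_insert hi, Finset.prod_insert hi, AddChar.map_add_eq_mul, ih]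

lemma sum_stdAddChar_dotProduct (p : ℕ) [NeZero p] {V : Type*} [Fintype V] [DecidableEq V]
    (z : V → ZMod p) :
    ∑ y : V → ZMod p, ZMod.stdAddChar (∑ v, y v * z v) =
      if z = 0 then (p : ℂ) ^ Fintype.card V else 0 := by
  have h1 : ∀ y : V → ZMod p, ZMod.stdAddChar (∑ v, y v * z v) =
      ∏ v, ZMod.stdAddChar (y v * z v) := fun y ↦ stdAddChar_sum _ _
  simp only [h1]
  have h2 := Finset.prod_univ_sum (fun _ : V ↦ (Finset.univ : Finset (ZMod p)))
    (fun v y ↦ ZMod.stdAddChar (y * z v))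
  rw [Fintype.piFinset_univ] at h2
  rw [← h2]
  simp only [AddChar.sum_mulShift _ (ZMod.isPrimitive_stdAddChar p), ZMod.card]
  split_ifs with h
  · simp [h]
  · obtain ⟨v, hv⟩ := Function.ne_iff.1 h
    refine Finset.prod_eq_zero (Finset.mem_univ v) ?_
    rw [if_neg (by simpa using hv), Nat.cast_zero]

/-- The size of the kernel of the laplacian, by orthogonality of characters. -/
lemma pow_finrank_lapKer (p : ℕ) [Fact p.Prime] {V : Type*} [Fintype V] [DecidableEq V]
    (G : SimpleGraph V) :
    (p : ℂ) ^ Fintype.card V * (p : ℂ) ^ Module.finrank (ZMod p) (G.lapKer p) =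
      ∑ x : V → ZMod p, ∑ y : V → ZMod p, ZMod.stdAddChar (∑ v, y v * G.lapAt x v) := by
  classical
  have h1 : (p : ℂ) ^ Module.finrank (ZMod p) (G.lapKer p) =
      ∑ x : V → ZMod p, if G.lapAt x = 0 then 1 else 0 := by
    have h2 := Module.card_eq_pow_finrank (K := ZMod p) (V := G.lapKer p)
    rw [ZMod.card] at h2
    rw [← Nat.cast_pow, ← h2, Finset.sum_boole]
    congr 1
    exact Fintype.card_of_subtype _ fun x ↦ by
      simp [SimpleGraph.mem_lapKer, funext_iff]
  rw [h1, Finset.mul_sum]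
  refine Finset.sum_congr rfl fun x _ ↦ ?_
  rw [sum_stdAddChar_dotProduct]
  split_ifs <;> simp

/-- The pairing of the laplacian applied to one vector with another vector is a sum of hyperbola
forms over the edges; `k` and `h` hold the values of both vectors on the two sides. -/
lemma sum_mul_lapAt_matrixGraph {p : ℕ} {L R : Type*} [Fintype L] [Fintype R]
    (M : L → R → Bool) (k : L → ZMod p × ZMod p) (h : R → ZMod p × ZMod p) :
    ∑ x, Sum.elim (fun v ↦ (k v).2) (fun u ↦ (h u).2) x *
      (matrixGraph M).lapAt (Sum.elim (fun v ↦ (k v).1) (fun u ↦ (h u).1)) x =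
      ∑ v, ∑ u, if M v u then hyp (k v) (h u) else 0 := by
  rw [Fintype.sum_sum_type]
  simp only [lapAt_matrixGraph_inl, lapAt_matrixGraph_inr, Sum.elim_inl, Sum.elim_inr,
    Finset.mul_sum]
  rw [Finset.sum_comm (s := (Finset.univ : Finset R)), ← Finset.sum_add_distrib]
  refine Finset.sum_congr rfl fun v _ ↦ ?_
  rw [← Finset.sum_add_distrib]
  refine Finset.sum_congr rfl fun u _ ↦ ?_
  split_ifs
  · rw [hyp]
    ring
  · simp

/-- The first moment of the size of the kernel of the laplacian, on the event that the degrees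
mod `p` of the vertices of `L` are given, factors over the vertices of `L`. -/
theorem sum_pow_finrank_lapKer (p : ℕ) [Fact p.Prime] {L R : Type*} [Fintype L] [Fintype R]
    [DecidableEq L] [DecidableEq R] (q : ℝ) (d : L → ZMod p) :
    (p : ℂ) ^ (Fintype.card L + Fintype.card R) *
      ∑ M : L → R → Bool, (∏ v, (rowWeight q (M v) : ℂ)) *
        (if ∀ v, rowDeg p (M v) = d v then 1 else 0) *
        (p : ℂ) ^ Module.finrank (ZMod p) ((matrixGraph M).lapKer p) =
      ∑ h : R → ZMod p × ZMod p, ∏ v, vertexSum p q (d v) h := by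
  have hpow : ∀ M : L → R → Bool, (p : ℂ) ^ (Fintype.card L + Fintype.card R) *
      (p : ℂ) ^ Module.finrank (ZMod p) ((matrixGraph M).lapKer p) =
      ∑ h : R → ZMod p × ZMod p, ∑ k : L → ZMod p × ZMod p,
        ∏ v, ZMod.stdAddChar (∑ u, if M v u then hyp (k v) (h u) else 0) := by
    intro M
    rw [← Fintype.card_sum, pow_finrank_lapKer, ← Fintype.sum_prod_type',
      ← Fintype.sum_prod_type' (f := fun (h : R → ZMod p × ZMod p) (k : L → ZMod p × ZMod p) ↦
        ∏ v, ZMod.stdAddChar (∑ u, if M v u then hyp (k v) (h u) else 0))]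
    symm
    refine Fintype.sum_bijective (fun c : (R → ZMod p × ZMod p) × (L → ZMod p × ZMod p) ↦
      ((Sum.elim (fun v ↦ (c.2 v).1) (fun u ↦ (c.1 u).1) : L ⊕ R → ZMod p),
        (Sum.elim (fun v ↦ (c.2 v).2) (fun u ↦ (c.1 u).2) : L ⊕ R → ZMod p))) ?_ _ _ ?_
    · refine Function.bijective_iff_has_inverse.2 ⟨fun c ↦
        (fun u ↦ (c.1 (Sum.inr u), c.2 (Sum.inr u)), fun v ↦ (c.1 (Sum.inl v), c.2 (Sum.inl v))),
        ?_, ?_⟩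
      · intro c
        rfl
      · intro c
        refine Prod.ext ?_ ?_ <;>
        · ext (x | x) <;> rfl
    · intro c
      rw [sum_mul_lapAt_matrixGraph, stdAddChar_sum]
  have hind : ∀ M : L → R → Bool, (if ∀ v, rowDeg p (M v) = d v then (1 : ℂ) else 0) =
      ∏ v, if rowDeg p (M v) = d v then 1 else 0 := by
    intro M
    rw [Finset.prod_ite_zero]
    simp
  rw [Finset.mul_sum]
  calc ∑ M : L → R → Bool, (p : ℂ) ^ (Fintype.card L + Fintype.card R) *
        ((∏ v, (rowWeight q (M v) : ℂ)) * (if ∀ v, rowDeg p (M v) = d v then 1 else 0) *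
        (p : ℂ) ^ Module.finrank (ZMod p) ((matrixGraph M).lapKer p))
      = ∑ M : L → R → Bool, ∑ h : R → ZMod p × ZMod p, ∑ k : L → ZMod p × ZMod p,
        ∏ v, ((rowWeight q (M v) : ℂ) * (if rowDeg p (M v) = d v then 1 else 0) *
          ZMod.stdAddChar (∑ u, if M v u then hyp (k v) (h u) else 0)) := by
        refine Finset.sum_congr rfl fun M _ ↦ ?_
        rw [mul_left_comm, hpow, hind, Finset.mul_sum]
        refine Finset.sum_congr rfl fun h _ ↦ ?_
        rw [Finset.mul_sum]
        refine Finset.sum_congr rfl fun k _ ↦ ?_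
        rw [Finset.prod_mul_distrib, Finset.prod_mul_distrib]
    _ = ∑ h : R → ZMod p × ZMod p, ∏ v, vertexSum p q (d v) h := by
        rw [Finset.sum_comm]
        refine Finset.sum_congr rfl fun h _ ↦ ?_
        simp only [vertexSum, Finset.mul_sum]
        have h1 := Finset.prod_univ_sum (fun _ : L ↦ (Finset.univ : Finset (R → Bool)))
          (fun v m ↦ ∑ k : ZMod p × ZMod p, (rowWeight q m : ℂ) *
            (if rowDeg p m = d v then 1 else 0) *
            ZMod.stdAddChar (∑ u, if m u then hyp k (h u) else 0))
        rw [Fintype.piFinset_univ] at h1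
        rw [h1]
        refine Finset.sum_congr rfl fun M _ ↦ ?_
        have h2 := Finset.prod_univ_sum (fun _ : L ↦ (Finset.univ : Finset (ZMod p × ZMod p)))
          (fun v k ↦ (rowWeight q (M v) : ℂ) * (if rowDeg p (M v) = d v then 1 else 0) *
            ZMod.stdAddChar (∑ u, if M v u then hyp k (h u) else 0))
        rw [Fintype.piFinset_univ] at h2
        rw [h2]

/-! ### Bounds for the contribution of a vertex -/

section vertexSum

variable {p : ℕ} [Fact p.Prime] {R : Type*} [Fintype R] {q ρ : ℝ}

/-- The characteristic function of a Bernoulli variable with values in `ZMod p`. -/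
noncomputable def bernoulliChar (p : ℕ) [NeZero p] (q : ℝ) (t : ZMod p) : ℂ :=
  (1 - q) + q * ZMod.stdAddChar t

lemma norm_stdAddChar (t : ZMod p) : ‖(ZMod.stdAddChar t : ℂ)‖ = 1 :=
  AddChar.norm_apply _ _

lemma norm_bernoulliChar_le_one (hq0 : 0 ≤ q) (hq1 : q ≤ 1) (t : ZMod p) :
    ‖bernoulliChar p q t‖ ≤ 1 := by
  refine (norm_add_le _ _).trans ?_
  rw [norm_mul, norm_stdAddChar, mul_one]
  have h1 : ‖(1 - q : ℂ)‖ = 1 - q := by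
    rw [← Complex.ofReal_one, ← Complex.ofReal_sub, Complex.norm_real, Real.norm_of_nonneg]
    linarith
  rw [h1, Complex.norm_real, Real.norm_of_nonneg hq0]
  linarith

/-- The entries take both of the values `0` and `1`, so a nontrivial character has a gain. -/
lemma norm_bernoulliChar_lt_one (hq0 : 0 < q) (hq1 : q < 1) {t : ZMod p} (ht : t ≠ 0) :
    ‖bernoulliChar p q t‖ < 1 := by
  have hne : (ZMod.stdAddChar t : ℂ) ≠ 1 := by
    intro h
    exact ht (ZMod.injective_stdAddChar (by rw [h, AddChar.map_zero_eq_one]))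
  set z : ℂ := ZMod.stdAddChar t
  have hz : z.re ^ 2 + z.im ^ 2 = 1 := by
    have := Complex.sq_norm z
    rw [norm_stdAddChar, Complex.normSq_apply] at this
    linarith
  have hre : z.re < 1 := by
    refine lt_of_le_of_ne (by nlinarith [sq_nonneg z.im]) fun h ↦ hne ?_
    refine Complex.ext (by simpa using h) ?_
    have : z.im ^ 2 = 0 := by rw [h] at hz; linarith
    simpa using this
  have h2 : ‖bernoulliChar p q t‖ ^ 2 = (1 - q + q * z.re) ^ 2 + (q * z.im) ^ 2 := by
    rw [Complex.sq_norm, Complex.normSq_apply, bernoulliChar]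
    simp [z]
    ring
  have h3 : ‖bernoulliChar p q t‖ ^ 2 < 1 := by
    have h4 : 0 < q * (1 - q) * (1 - z.re) := by
      have : 0 < 1 - z.re := by linarith
      have : 0 < 1 - q := by linarith
      positivity
    have h5 : (1 - q + q * z.re) ^ 2 + (q * z.im) ^ 2 = 1 - 2 * (q * (1 - q) * (1 - z.re)) := by
      linear_combination q ^ 2 * hz
    linarith
  exact (sq_lt_one_iff₀ (norm_nonneg _)).1 h3

lemma exists_norm_bernoulliChar_le (p : ℕ) [Fact p.Prime] (hq0 : 0 < q) (hq1 : q < 1) :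
    ∃ ρ : ℝ, 0 < ρ ∧ ρ < 1 ∧ ∀ t : ZMod p, t ≠ 0 → ‖bernoulliChar p q t‖ ≤ ρ := by
  obtain ⟨t, ht, hmax⟩ := Finset.exists_max_image (Finset.univ.filter fun t : ZMod p ↦ t ≠ 0)
    (fun t ↦ ‖bernoulliChar p q t‖) ⟨1, by simp⟩
  refine ⟨max (1 / 2) ‖bernoulliChar p q t‖, lt_max_of_lt_left (by norm_num),
    max_lt (by norm_num) (norm_bernoulliChar_lt_one hq0 hq1 (Finset.mem_filter.1 ht).2),
    fun s hs ↦ le_max_of_le_right (hmax s (by simpa using hs))⟩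

lemma rowWeight_nonneg (hq0 : 0 ≤ q) (hq1 : q ≤ 1) (m : R → Bool) : 0 ≤ rowWeight q m :=
  Finset.prod_nonneg fun u _ ↦ by split_ifs <;> linarith

lemma prod_norm_bernoulliChar_le (hq0 : 0 ≤ q) (hq1 : q ≤ 1)
    (hρ : ∀ t : ZMod p, t ≠ 0 → ‖bernoulliChar p q t‖ ≤ ρ) (c : R → ZMod p) :
    ∏ u, ‖bernoulliChar p q (c u)‖ ≤ ρ ^ (Finset.univ.filter fun u ↦ c u ≠ 0).card := by
  rw [← Finset.prod_const, Finset.prod_filter]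
  refine Finset.prod_le_prod (fun u _ ↦ norm_nonneg _) fun u _ ↦ ?_
  split_ifs with hu
  · exact hρ _ hu
  · exact norm_bernoulliChar_le_one hq0 hq1 _

/-- Each sum over the values at the vertex is a Gauss sum if the degree is not zero mod `p`. -/
lemma norm_sum_stdAddChar_hyp_le {m : R → Bool} (hm : rowDeg p m ≠ 0)
    (h : R → ZMod p × ZMod p) :
    ‖∑ k : ZMod p × ZMod p, (ZMod.stdAddChar (∑ u, if m u then hyp k (h u) else 0) : ℂ)‖ ≤ p := by
  set e := rowDeg p m
  set A := ∑ u, if m u then (h u).1 else 0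
  set B := ∑ u, if m u then (h u).2 else 0
  set C := ∑ u, if m u then (h u).1 * (h u).2 else 0
  have h1 : ∀ k : ZMod p × ZMod p, (∑ u, if m u then hyp k (h u) else 0) =
      (C - k.1 * B) + k.2 * (e * k.1 - A) := by
    intro k
    have : (C - k.1 * B) + k.2 * (e * k.1 - A) = C - k.1 * B + k.1 * k.2 * e - k.2 * A := by ring
    rw [this]
    simp only [A, B, C, e, rowDeg, Finset.mul_sum, ← Finset.sum_sub_distrib,
      ← Finset.sum_add_distrib]
    refine Finset.sum_congr rfl fun u _ ↦ ?_
    split_ifs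
    · rw [hyp]
      ring
    · simp
  have h2 : ∑ k : ZMod p × ZMod p, (ZMod.stdAddChar (∑ u, if m u then hyp k (h u) else 0) : ℂ) =
      ∑ x : ZMod p, if e * x - A = 0 then ZMod.stdAddChar (C - x * B) * (p : ℂ) else 0 := by
    simp only [h1]
    rw [Fintype.sum_prod_type]
    refine Finset.sum_congr rfl fun x _ ↦ ?_
    simp only [AddChar.map_add_eq_mul]
    rw [← Finset.mul_sum, AddChar.sum_mulShift _ (ZMod.isPrimitive_stdAddChar p), ZMod.card]
    split_ifs <;> simp
  have h3 : ∀ x : ZMod p, e * x - A = 0 ↔ x = e⁻¹ * A := by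
    intro x
    rw [sub_eq_zero]
    constructor
    · rintro hx
      rw [← hx, inv_mul_cancel_left₀ hm]
    · rintro rfl
      rw [mul_inv_cancel_left₀ hm]
  rw [h2]
  simp only [h3, Finset.sum_ite_eq', Finset.mem_univ, if_true]
  rw [norm_mul, norm_stdAddChar, one_mul, Complex.norm_natCast]

variable [DecidableEq R]

lemma sum_rowWeight_mul_stdAddChar (c : R → ZMod p) :
    ∑ m : R → Bool, (rowWeight q m : ℂ) * ZMod.stdAddChar (∑ u, if m u then c u else 0) =
      ∏ u, bernoulliChar p q (c u) := by
  have h1 := Finset.prod_univ_sum (fun _ : R ↦ (Finset.univ : Finset Bool))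
    (fun u b ↦ ((if b then q else 1 - q : ℝ) : ℂ) * ZMod.stdAddChar (if b then c u else 0))
  rw [Fintype.piFinset_univ] at h1
  have h2 : ∀ u, ∑ b : Bool, ((if b then q else 1 - q : ℝ) : ℂ) *
      ZMod.stdAddChar (if b then c u else 0) = bernoulliChar p q (c u) := by
    intro u
    simp [bernoulliChar, add_comm]
  simp only [h2] at h1
  rw [h1]
  refine Finset.sum_congr rfl fun m _ ↦ ?_
  rw [stdAddChar_sum, rowWeight, Complex.ofReal_prod, ← Finset.prod_mul_distrib]

lemma sum_rowWeight (p : ℕ) [Fact p.Prime] (q : ℝ) : ∑ m : R → Bool, rowWeight q m = 1 := by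
  have h := sum_rowWeight_mul_stdAddChar (q := q) (fun _ : R ↦ (0 : ZMod p))
  simp [bernoulliChar] at h
  exact_mod_cast h

lemma card_mul_ite_eq_sum_stdAddChar (a e : ZMod p) :
    (p : ℂ) * (if a = e then 1 else 0) = ∑ t : ZMod p, ZMod.stdAddChar (t * (a - e)) := by
  rw [AddChar.sum_mulShift _ (ZMod.isPrimitive_stdAddChar p), ZMod.card]
  simp [sub_eq_zero]

/-- The probability that the sum mod `p` of a random `0`-`1` vector is `e`. -/
noncomputable def rowProb {p : ℕ} (R : Type*) [Fintype R] [DecidableEq R] (q : ℝ)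
    (e : ZMod p) : ℝ :=
  ∑ m : R → Bool, rowWeight q m * if rowDeg p m = e then 1 else 0

/-- The sum mod `p` of a random `0`-`1` vector is exponentially close to being uniform. -/
lemma abs_rowProb_sub_le (hρ0 : 0 ≤ ρ) (hρ : ∀ t : ZMod p, t ≠ 0 → ‖bernoulliChar p q t‖ ≤ ρ)
    (e : ZMod p) :
    |p * rowProb R q e - 1| ≤ p * ρ ^ Fintype.card R := by
  have h1 : ((p * rowProb R q e : ℝ) : ℂ) =
      ∑ t : ZMod p, ZMod.stdAddChar (-(t * e)) * bernoulliChar p q t ^ Fintype.card R := by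
    have h2 : ∀ t : ZMod p, bernoulliChar p q t ^ Fintype.card R =
        ∑ m : R → Bool, (rowWeight q m : ℂ) * ZMod.stdAddChar (t * rowDeg p m) := by
      intro t
      have := sum_rowWeight_mul_stdAddChar (q := q) (fun _ : R ↦ t)
      rw [Finset.prod_const, Finset.card_univ] at this
      rw [← this]
      refine Finset.sum_congr rfl fun m _ ↦ ?_
      simp only [rowDeg, Finset.mul_sum, mul_ite, mul_one, mul_zero]
    simp only [h2, Finset.mul_sum]
    rw [Finset.sum_comm, rowProb]
    push_cast
    rw [Finset.mul_sum]
    refine Finset.sum_congr rfl fun m _ ↦ ?_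
    rw [mul_left_comm]
    have h3 := card_mul_ite_eq_sum_stdAddChar (rowDeg p m) e
    have h4 : ((if rowDeg p m = e then (1 : ℝ) else 0 : ℝ) : ℂ) =
      if rowDeg p m = e then 1 else 0 := by split_ifs <;> simp
    rw [h4, h3, Finset.mul_sum]
    refine Finset.sum_congr rfl fun t _ ↦ ?_
    rw [mul_left_comm, ← AddChar.map_add_eq_mul]
    congr 2
    ring
  have h5 : ((p * rowProb R q e - 1 : ℝ) : ℂ) = ∑ t ∈ Finset.univ.erase (0 : ZMod p),
      ZMod.stdAddChar (-(t * e)) * bernoulliChar p q t ^ Fintype.card R := by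
    rw [Complex.ofReal_sub, h1, ← Finset.add_sum_erase _ _ (Finset.mem_univ (0 : ZMod p))]
    simp [bernoulliChar]
  rw [← Real.norm_eq_abs, ← Complex.norm_real, h5]
  refine (norm_sum_le _ _).trans ?_
  refine (Finset.sum_le_card_nsmul _ _ (ρ ^ Fintype.card R) fun t ht ↦ ?_).trans ?_
  · rw [norm_mul, norm_stdAddChar, one_mul, norm_pow]
    exact pow_le_pow_left₀ (norm_nonneg _) (hρ t (Finset.ne_of_mem_erase ht)) _
  · rw [nsmul_eq_mul]
    refine mul_le_mul_of_nonneg_right ?_ (by positivity)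
    exact_mod_cast (Finset.card_erase_le).trans (by rw [Finset.card_univ, ZMod.card])

lemma norm_vertexSum_le_of_forall (hq0 : 0 ≤ q) (hq1 : q ≤ 1) (e : ZMod p)
    (h : R → ZMod p × ZMod p) {c : ℝ}
    (hc : ∀ m : R → Bool, rowDeg p m = e → ‖∑ k : ZMod p × ZMod p,
      (ZMod.stdAddChar (∑ u, if m u then hyp k (h u) else 0) : ℂ)‖ ≤ c) :
    ‖vertexSum p q e h‖ ≤ c * rowProb R q e := by
  refine (norm_sum_le _ _).trans ?_
  rw [rowProb, Finset.mul_sum]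
  refine Finset.sum_le_sum fun m _ ↦ ?_
  rw [norm_mul, norm_mul, Complex.norm_real, Real.norm_of_nonneg (rowWeight_nonneg hq0 hq1 m)]
  split_ifs with hm
  · rw [norm_one, mul_one, mul_comm]
    exact mul_le_mul_of_nonneg_right (hc m hm) (rowWeight_nonneg hq0 hq1 m)
  · simp

lemma norm_vertexSum_le (hq0 : 0 ≤ q) (hq1 : q ≤ 1) (e : ZMod p) (h : R → ZMod p × ZMod p) :
    ‖vertexSum p q e h‖ ≤ p ^ 2 * rowProb R q e := by
  refine norm_vertexSum_le_of_forall hq0 hq1 e h fun m _ ↦ (norm_sum_le _ _).trans ?_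
  simp only [norm_stdAddChar]
  simp [ZMod.card, sq]

lemma norm_vertexSum_le_of_ne_zero (hq0 : 0 ≤ q) (hq1 : q ≤ 1) {e : ZMod p} (he : e ≠ 0)
    (h : R → ZMod p × ZMod p) : ‖vertexSum p q e h‖ ≤ p * rowProb R q e :=
  norm_vertexSum_le_of_forall hq0 hq1 e h fun m hm ↦
    norm_sum_stdAddChar_hyp_le (by rwa [hm]) h

/-- Expanding the condition on the degree in characters makes the entries independent. -/
lemma card_mul_vertexSum (e : ZMod p) (h : R → ZMod p × ZMod p) :
    p * vertexSum p q e h = ∑ k : ZMod p × ZMod p, ∑ t : ZMod p,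
      ZMod.stdAddChar (t * e) * ∏ u, bernoulliChar p q (hyp k (h u) - t) := by
  have h2 : ∀ (k : ZMod p × ZMod p) (t : ZMod p), ∏ u, bernoulliChar p q (hyp k (h u) - t) =
      ∑ m : R → Bool, (rowWeight q m : ℂ) *
        ZMod.stdAddChar ((∑ u, if m u then hyp k (h u) else 0) - t * rowDeg p m) := by
    intro k t
    rw [← sum_rowWeight_mul_stdAddChar]
    refine Finset.sum_congr rfl fun m _ ↦ ?_
    congr 2
    rw [rowDeg, Finset.mul_sum, ← Finset.sum_sub_distrib]
    refine Finset.sum_congr rfl fun u _ ↦ ?_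
    split_ifs <;> simp
  simp only [h2, Finset.mul_sum, vertexSum]
  rw [Finset.sum_comm]
  refine Finset.sum_congr rfl fun k _ ↦ ?_
  rw [Finset.sum_comm]
  refine Finset.sum_congr rfl fun m _ ↦ ?_
  have h3 : (p : ℂ) * (if rowDeg p m = e then 1 else 0) =
      ∑ t : ZMod p, ZMod.stdAddChar (t * e - t * rowDeg p m) := by
    simp only [eq_comm (a := rowDeg p m), card_mul_ite_eq_sum_stdAddChar, mul_sub]
  calc _ = (rowWeight q m : ℂ) * ZMod.stdAddChar (∑ u, if m u then hyp k (h u) else 0) *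
        ((p : ℂ) * (if rowDeg p m = e then 1 else 0)) := by ring
    _ = _ := by
      rw [h3, Finset.mul_sum]
      refine Finset.sum_congr rfl fun t _ ↦ ?_
      rw [mul_left_comm, mul_assoc, ← AddChar.map_add_eq_mul, ← AddChar.map_add_eq_mul]
      congr 2
      ring

/-- The hyperbolas containing all but at most `D` of the points `h u`. -/
def nearSet (D : ℕ) (h : R → ZMod p × ZMod p) : Finset (Hyperbola p) :=
  Finset.univ.filter fun κ ↦ (Finset.univ.filter fun u ↦ hyp κ.1 (h u) ≠ κ.2).card ≤ D

/-- Only the hyperbolas containing almost all of the points `h u` matter. -/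
lemma card_mul_norm_vertexSum_le (hq0 : 0 ≤ q) (hq1 : q ≤ 1) (hρ0 : 0 ≤ ρ) (hρ1 : ρ ≤ 1)
    (hρ : ∀ t : ZMod p, t ≠ 0 → ‖bernoulliChar p q t‖ ≤ ρ) (D : ℕ) (e : ZMod p)
    (h : R → ZMod p × ZMod p) :
    p * ‖vertexSum p q e h‖ ≤
      ∑ κ ∈ nearSet D h, ∏ u, ‖bernoulliChar p q (hyp κ.1 (h u) - κ.2)‖ + p ^ 3 * ρ ^ D := by
  have h1 : p * ‖vertexSum p q e h‖ ≤ ∑ κ : Hyperbola p,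
      ∏ u, ‖bernoulliChar p q (hyp κ.1 (h u) - κ.2)‖ := by
    have h2 : p * ‖vertexSum p q e h‖ = ‖(p : ℂ) * vertexSum p q e h‖ := by
      rw [norm_mul, Complex.norm_natCast]
    rw [h2, card_mul_vertexSum, ← Fintype.sum_prod_type']
    refine (norm_sum_le _ _).trans (Finset.sum_le_sum fun κ _ ↦ ?_)
    rw [norm_mul, norm_stdAddChar, one_mul, norm_prod]
  refine h1.trans ?_
  rw [← Finset.sum_filter_add_sum_filter_not Finset.univ (fun κ ↦ κ ∈ nearSet D h)]
  refine add_le_add (by simp) ?_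
  refine (Finset.sum_le_card_nsmul _ _ (ρ ^ D) fun κ hκ ↦ ?_).trans ?_
  · refine (prod_norm_bernoulliChar_le hq0 hq1 hρ _).trans (pow_le_pow_of_le_one hρ0 hρ1 ?_)
    have := (Finset.mem_filter.1 hκ).2
    rw [nearSet, Finset.mem_filter] at this
    simp only [Finset.mem_univ, true_and, not_le] at this
    simpa only [sub_ne_zero] using this.le
  · rw [nsmul_eq_mul]
    refine mul_le_mul_of_nonneg_right ?_ (by positivity)
    have : (Finset.univ.filter fun κ ↦ κ ∉ nearSet D h).card ≤ p ^ 3 := by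
      refine (Finset.card_le_univ _).trans (le_of_eq ?_)
      simp only [Fintype.card_prod, ZMod.card]
      ring
    exact_mod_cast this

lemma card_mul_norm_vertexSum_le_card (hq0 : 0 ≤ q) (hq1 : q ≤ 1) (hρ0 : 0 ≤ ρ) (hρ1 : ρ ≤ 1)
    (hρ : ∀ t : ZMod p, t ≠ 0 → ‖bernoulliChar p q t‖ ≤ ρ) (D : ℕ) (e : ZMod p)
    (h : R → ZMod p × ZMod p) :
    p * ‖vertexSum p q e h‖ ≤ (nearSet D h).card + p ^ 3 * ρ ^ D := by
  refine (card_mul_norm_vertexSum_le hq0 hq1 hρ0 hρ1 hρ D e h).trans (add_le_add_left ?_ _)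
  refine (Finset.sum_le_card_nsmul _ _ 1 fun κ _ ↦ ?_).trans (by simp)
  exact Finset.prod_le_one (fun u _ ↦ norm_nonneg _) fun u _ ↦ norm_bernoulliChar_le_one hq0 hq1 _

/-- One of the hyperbolas missing a point yields a gain. -/
lemma card_mul_norm_vertexSum_le_card_sub (hq0 : 0 ≤ q) (hq1 : q ≤ 1) (hρ0 : 0 ≤ ρ)
    (hρ1 : ρ ≤ 1) (hρ : ∀ t : ZMod p, t ≠ 0 → ‖bernoulliChar p q t‖ ≤ ρ) (D : ℕ) (e : ZMod p)
    (h : R → ZMod p × ZMod p) {κ : Hyperbola p} (hκ : κ ∈ nearSet D h) {u : R}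
    (hu : hyp κ.1 (h u) ≠ κ.2) :
    p * ‖vertexSum p q e h‖ ≤ (nearSet D h).card - (1 - ρ) + p ^ 3 * ρ ^ D := by
  refine (card_mul_norm_vertexSum_le hq0 hq1 hρ0 hρ1 hρ D e h).trans (add_le_add_left ?_ _)
  have hle : ∀ κ : Hyperbola p,
      ∏ u, ‖bernoulliChar p q (hyp κ.1 (h u) - κ.2)‖ ≤ 1 := fun κ ↦
    Finset.prod_le_one (fun u _ ↦ norm_nonneg _) fun u _ ↦ norm_bernoulliChar_le_one hq0 hq1 _
  have h1 : ∏ u, ‖bernoulliChar p q (hyp κ.1 (h u) - κ.2)‖ ≤ ρ := by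
    refine (prod_norm_bernoulliChar_le hq0 hq1 hρ _).trans ?_
    refine (pow_le_pow_of_le_one hρ0 hρ1 (Finset.one_le_card.2 ⟨u, ?_⟩)).trans (pow_one ρ).le
    simpa [sub_eq_zero] using hu
  rw [← Finset.add_sum_erase _ _ hκ]
  have h2 := Finset.sum_le_card_nsmul ((nearSet D h).erase κ) _ 1 (fun κ _ ↦ hle κ)
  rw [Finset.card_erase_of_mem hκ, nsmul_eq_mul, mul_one,
    Nat.cast_sub (Finset.card_pos.2 ⟨κ, hκ⟩), Nat.cast_one] at h2
  linarith

end vertexSum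

/-! ### Intersections of hyperbolas -/

section hyp

variable {p : ℕ} [Fact p.Prime] {R : Type*} [Fintype R]

lemma hyp_comm (k z : ZMod p × ZMod p) : hyp k z = hyp z k := by
  rw [hyp, hyp]
  ring

/-- The difference of two different hyperbola forms is a nonconstant affine form. -/
lemma card_hyp_sub_hyp_eq_le {z z' : ZMod p × ZMod p} (hz : z ≠ z') (c : ZMod p) :
    (Finset.univ.filter fun k ↦ hyp k z - hyp k z' = c).card ≤ p := by
  have h0 : ∀ k : ZMod p × ZMod p, hyp k z - hyp k z' =
      z.1 * z.2 - z'.1 * z'.2 - k.1 * (z.2 - z'.2) - k.2 * (z.1 - z'.1) := fun k ↦ by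
    rw [hyp, hyp]
    ring
  have hp : (Finset.univ : Finset (ZMod p)).card = p := by rw [Finset.card_univ, ZMod.card]
  by_cases h1 : z.1 = z'.1
  · have h2 : z.2 - z'.2 ≠ 0 := fun h2 ↦ hz (Prod.ext h1 (sub_eq_zero.1 h2))
    refine (Finset.card_le_card_of_injOn Prod.snd (fun k _ ↦ Finset.mem_univ k.2) ?_).trans hp.le
    intro k hk l hl hkl
    simp only [Finset.coe_filter, Finset.mem_univ, true_and, Set.mem_ofPred_eq, h0] at hk hl
    refine Prod.ext (mul_right_cancel₀ h2 ?_) hkl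
    have hkl' : k.2 = l.2 := hkl
    rw [hkl'] at hk
    linear_combination hl - hk
  · have h2 : z.1 - z'.1 ≠ 0 := sub_ne_zero.2 h1
    refine (Finset.card_le_card_of_injOn Prod.fst (fun k _ ↦ Finset.mem_univ k.1) ?_).trans hp.le
    intro k hk l hl hkl
    simp only [Finset.coe_filter, Finset.mem_univ, true_and, Set.mem_ofPred_eq, h0] at hk hl
    refine Prod.ext hkl (mul_right_cancel₀ h2 ?_)
    have hkl' : k.1 = l.1 := hkl
    rw [hkl'] at hk
    linear_combination hl - hk

/-- The intersection of the hyperbolas `hyp κ₁ z = κ₂` and `hyp κ'₁ z = κ'₂`. -/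
def hypInter (κ κ' : Hyperbola p) : Finset (ZMod p × ZMod p) :=
  Finset.univ.filter fun z ↦ hyp κ.1 z = κ.2 ∧ hyp κ'.1 z = κ'.2

/-- On the intersection, the difference of the two forms is prescribed. -/
lemma card_hypInter_le {κ κ' : Hyperbola p} (h : κ.1 ≠ κ'.1) :
    (hypInter κ κ').card ≤ p := by
  refine (Finset.card_le_card ?_).trans (card_hyp_sub_hyp_eq_le h (κ.2 - κ'.2))
  intro z hz
  obtain ⟨h1, h2⟩ := (Finset.mem_filter.1 hz).2
  rw [Finset.mem_filter, hyp_comm z, hyp_comm z, h1, h2]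
  exact ⟨Finset.mem_univ _, rfl⟩

/-- The number of values of `h` outside `K`. -/
def excCard {T : Type*} [DecidableEq T] (K : Finset T) (h : R → T) : ℕ :=
  (Finset.univ.filter fun u ↦ h u ∉ K).card

lemma mem_nearSet {D : ℕ} {h : R → ZMod p × ZMod p} {κ : Hyperbola p} :
    κ ∈ nearSet D h ↔ (Finset.univ.filter fun u ↦ hyp κ.1 (h u) ≠ κ.2).card ≤ D := by
  simp [nearSet]

/-- Different hyperbolas with the same centre are disjoint, so at most one of them contains more
than half of the points. -/
lemma eq_of_mem_nearSet {D : ℕ} (hD : 2 * D < Fintype.card R) {h : R → ZMod p × ZMod p}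
    {κ κ' : Hyperbola p} (hκ : κ ∈ nearSet D h) (hκ' : κ' ∈ nearSet D h)
    (heq : κ.1 = κ'.1) : κ = κ' := by
  classical
  by_contra hne
  have h2 : κ.2 ≠ κ'.2 := fun h2 ↦ hne (Prod.ext heq h2)
  rw [mem_nearSet] at hκ hκ'
  have hcover : (Finset.univ : Finset R) ⊆ (Finset.univ.filter fun u ↦ hyp κ.1 (h u) ≠ κ.2) ∪
      (Finset.univ.filter fun u ↦ hyp κ'.1 (h u) ≠ κ'.2) := by
    intro u _
    by_contra hu
    simp only [Finset.mem_union, Finset.mem_filter, Finset.mem_univ, true_and, not_or,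
      not_not] at hu
    rw [← heq, hu.1] at hu
    exact h2 hu.2
  have := (Finset.card_le_card hcover).trans (Finset.card_union_le _ _)
  rw [Finset.card_univ] at this
  omega

lemma card_nearSet_le {D : ℕ} (hD : 2 * D < Fintype.card R) {h : R → ZMod p × ZMod p}
    {S : Finset (ZMod p × ZMod p)} (hS : ∀ κ ∈ nearSet D h, κ.1 ∈ S) :
    (nearSet D h).card ≤ S.card :=
  Finset.card_le_card_of_injOn Prod.fst (fun κ hκ ↦ hS κ hκ)
    fun _ hκ _ hκ' heq ↦ eq_of_mem_nearSet hD hκ hκ' heq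

/-- If `h` is not nearly constant, then the hyperbolas containing almost all of its values
contain two common points, so there are at most `p` of them. -/
lemma card_nearSet_le_of_lt_excCard [Nonempty R] {D : ℕ} (hD : 2 * D < Fintype.card R)
    {h : R → ZMod p × ZMod p} (hexc : ∀ z, p ^ 2 * D < excCard {z} h) :
    (nearSet D h).card ≤ p := by
  classical
  set cnt : ZMod p × ZMod p → ℕ := fun z ↦ (Finset.univ.filter fun u ↦ h u = z).card
  obtain ⟨z, -, hz⟩ := Finset.exists_max_image Finset.univ cnt Finset.univ_nonempty
  -- The most frequent value `z` is not enough to cover almost all of the points, so by the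
  -- pigeonhole principle some other value `z'` is taken more than `D` times.
  have h1 : ∃ z', z' ≠ z ∧ D < cnt z' := by
    by_contra! hcon
    refine (hexc z).not_ge ?_
    have h2 : excCard {z} h = ∑ z' ∈ Finset.univ.erase z, cnt z' := by
      rw [excCard, Finset.card_eq_sum_card_fiberwise (f := h) (t := Finset.univ.erase z)]
      · refine Finset.sum_congr rfl fun z' hz' ↦ ?_
        congr 1
        ext u
        simp only [Finset.mem_filter, Finset.mem_univ, true_and, Finset.mem_singleton,
          and_iff_right_iff_imp]
        rintro rfl
        exact Finset.ne_of_mem_erase hz'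
      · intro u hu
        simpa using hu
    rw [h2]
    refine (Finset.sum_le_card_nsmul _ _ D fun z' hz' ↦
      hcon z' (Finset.ne_of_mem_erase hz')).trans ?_
    rw [smul_eq_mul]
    refine Nat.mul_le_mul_right _ (Finset.card_erase_le.trans (le_of_eq ?_))
    simp [ZMod.card, sq]
  obtain ⟨z', hne, hz'⟩ := h1
  have hval : ∀ κ ∈ nearSet D h, ∀ w, D < cnt w → hyp κ.1 w = κ.2 := by
    intro κ hκ w hw
    by_contra hcon
    refine (hw.trans_le ((Finset.card_le_card ?_).trans (mem_nearSet.1 hκ))).false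
    intro u hu
    rw [Finset.mem_filter] at hu ⊢
    exact ⟨hu.1, by rwa [hu.2]⟩
  refine (card_nearSet_le hD (S := Finset.univ.filter fun k ↦ hyp k z' - hyp k z = 0)
    fun κ hκ ↦ ?_).trans (card_hyp_sub_hyp_eq_le hne 0)
  rw [Finset.mem_filter, hval κ hκ z' hz',
    hval κ hκ z (hz'.trans_le (hz z' (Finset.mem_univ _))), sub_self]
  exact ⟨Finset.mem_univ _, rfl⟩

/-- An exponential Markov bound for the number of maps with few values outside `K`. -/
lemma card_excCard_le_mul_pow [DecidableEq R] {T : Type*} [Fintype T] [DecidableEq T]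
    (K : Finset T) (D : ℕ) {s : ℝ} (hs0 : 0 ≤ s) (hs1 : s ≤ 1) :
    ((Finset.univ.filter fun h : R → T ↦ excCard K h ≤ D).card : ℝ) * s ^ D ≤
      (K.card + s * Fintype.card T) ^ Fintype.card R := by
  have h1 := Finset.prod_univ_sum (fun _ : R ↦ (Finset.univ : Finset T))
    (fun _ z ↦ if z ∉ K then s else 1)
  rw [Fintype.piFinset_univ, Finset.prod_const, Finset.card_univ] at h1
  have h2 : ∑ z : T, (if z ∉ K then s else 1) ≤ K.card + s * Fintype.card T := by
    calc ∑ z : T, (if z ∉ K then s else 1) ≤ ∑ z : T, ((if z ∈ K then 1 else 0) + s) := by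
          refine Finset.sum_le_sum fun z _ ↦ ?_
          by_cases hz : z ∈ K
          · simpa [hz] using hs0
          · simp [hz]
      _ = K.card + s * Fintype.card T := by
          rw [Finset.sum_add_distrib]
          simp [mul_comm]
  have h3 : ∀ h : R → T, ∏ u, (if h u ∉ K then s else 1) = s ^ excCard K h := by
    intro h
    rw [← Finset.prod_filter, Finset.prod_const, excCard]
  simp only [h3] at h1
  refine le_trans ?_ (pow_le_pow_left₀ (Finset.sum_nonneg fun z _ ↦ by split_ifs <;> linarith) h2 _)
  rw [h1, ← nsmul_eq_mul]
  refine (Finset.card_nsmul_le_sum _ _ _ fun h hh ↦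
    pow_le_pow_of_le_one hs0 hs1 (Finset.mem_filter.1 hh).2).trans ?_
  exact Finset.sum_le_univ_sum_of_nonneg fun h ↦ by positivity

end hyp

/-! ### Summing the contributions -/

section sum

variable {p : ℕ} [Fact p.Prime] {R : Type*} [Fintype R] [DecidableEq R] {q ρ : ℝ}

/-- According to the hyperbolas that contain almost all of the values of `h`, there are five cases:
there is at most one hyperbola; `h` takes its values in the intersection of two of them; or does so
with few exceptions, and the contributions have a gain; `h` is constant; `h` has few exceptional
values, and the contributions in degree zero have a gain. -/
lemma vertexSum_cases (hq0 : 0 ≤ q) (hq1 : q ≤ 1) (hρ0 : 0 ≤ ρ) (hρ1 : ρ ≤ 1)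
    (hρ : ∀ t : ZMod p, t ≠ 0 → ‖bernoulliChar p q t‖ ≤ ρ) {D : ℕ}
    (hD : p ^ 2 * D < Fintype.card R) (h : R → ZMod p × ZMod p) {f : ZMod p → ℝ} {τ : ℝ}
    (hf : ∀ e, f e = p * ‖vertexSum p q e h‖) (hτ : τ = p ^ 3 * ρ ^ D) :
    (∀ e, f e ≤ 1 + τ) ∨
    (∃ κ κ' : Hyperbola p, κ.1 ≠ κ'.1 ∧ (∀ u, h u ∈ hypInter κ κ') ∧
      ∀ e, f e ≤ p + τ) ∨
    (∃ κ κ' : Hyperbola p, κ.1 ≠ κ'.1 ∧ excCard (hypInter κ κ') h ≤ p ^ 2 * D ∧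
      ∀ e, f e ≤ p - (1 - ρ) + τ) ∨
    (∃ z, (∀ u, h u = z) ∧ (∀ e, e ≠ 0 → f e ≤ p * (1 + τ)) ∧ f 0 ≤ p ^ 2 * (1 + τ)) ∨
    (∃ z, excCard {z} h ≤ p ^ 2 * D ∧ (∀ e, e ≠ 0 → f e ≤ p * (1 + τ)) ∧
      f 0 ≤ p ^ 2 - (1 - ρ) + τ) := by
  classical
  have hp2 : 2 ≤ p := (Fact.out : p.Prime).two_le
  have hp2' : (2 : ℝ) ≤ p := by exact_mod_cast hp2
  have hsq : 2 * D ≤ p ^ 2 * D := Nat.mul_le_mul_right _ (by nlinarith)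
  have h2D : 2 * D < Fintype.card R := by omega
  have hDR : D ≤ Fintype.card R := by omega
  have : Nonempty R := Fintype.card_pos_iff.1 (by omega)
  have hcard : ∀ e, f e ≤ (nearSet D h).card + τ := fun e ↦ by
    rw [hf, hτ]
    exact card_mul_norm_vertexSum_le_card hq0 hq1 hρ0 hρ1 hρ D e h
  have hgain : ∀ κ ∈ nearSet D h, ∀ u, hyp κ.1 (h u) ≠ κ.2 →
      ∀ e, f e ≤ (nearSet D h).card - (1 - ρ) + τ := fun κ hκ u hu e ↦ by
    rw [hf, hτ]
    exact card_mul_norm_vertexSum_le_card_sub hq0 hq1 hρ0 hρ1 hρ D e h hκ hu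
  have hprob : ∀ e : ZMod p, p * rowProb R q e ≤ 1 + τ := by
    intro e
    have h1 := (abs_le.1 (abs_rowProb_sub_le (R := R) hρ0 hρ e)).2
    have h2 : (p : ℝ) * ρ ^ Fintype.card R ≤ p ^ 3 * ρ ^ D := by
      have h3 : (p : ℝ) ≤ p ^ 3 := le_self_pow₀ (by linarith) (by norm_num)
      exact mul_le_mul h3 (pow_le_pow_of_le_one hρ0 hρ1 hDR) (by positivity) (by positivity)
    linarith
  have hne : ∀ e, e ≠ 0 → f e ≤ p * (1 + τ) := by
    intro e he
    rw [hf]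
    have := norm_vertexSum_le_of_ne_zero hq0 hq1 he h
    exact mul_le_mul_of_nonneg_left (this.trans (hprob e)) (by positivity)
  by_cases hconst : ∃ z, excCard {z} h ≤ p ^ 2 * D
  · obtain ⟨z, hz⟩ := hconst
    right; right; right
    by_cases hall : ∀ u, h u = z
    · refine Or.inl ⟨z, hall, hne, ?_⟩
      rw [hf]
      have h1 := norm_vertexSum_le hq0 hq1 0 h
      have h2 : (p : ℝ) * ‖vertexSum p q 0 h‖ ≤ p * (p ^ 2 * rowProb R q 0) :=
        mul_le_mul_of_nonneg_left h1 (by positivity)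
      refine h2.trans ?_
      rw [mul_left_comm]
      exact mul_le_mul_of_nonneg_left (hprob 0) (by positivity)
    · refine Or.inr ⟨z, hz, hne, ?_⟩
      push Not at hall
      obtain ⟨u₁, hu₁⟩ := hall
      obtain ⟨u₀, hu₀⟩ : ∃ u, h u = z := by
        by_contra! hcon
        have : excCard {z} h = Fintype.card R := by
          rw [excCard, Finset.filter_true_of_mem (by simpa using hcon), Finset.card_univ]
        omega
      by_cases hex : ∀ κ ∈ nearSet D h, ∀ u, hyp κ.1 (h u) = κ.2
      · have h1 : (nearSet D h).card ≤ p := by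
          refine (card_nearSet_le h2D
            (S := Finset.univ.filter fun k ↦ hyp k (h u₁) - hyp k z = 0)
            fun κ hκ ↦ ?_).trans (card_hyp_sub_hyp_eq_le hu₁ 0)
          rw [Finset.mem_filter, ← hu₀, hex κ hκ, hex κ hκ, sub_self]
          exact ⟨Finset.mem_univ _, rfl⟩
        have h2 : ((nearSet D h).card : ℝ) ≤ p := by exact_mod_cast h1
        have h3 := hcard 0
        nlinarith
      · push Not at hex
        obtain ⟨κ, hκ, u, hu⟩ := hex
        refine (hgain κ hκ u hu 0).trans ?_
        have h1 : (nearSet D h).card ≤ p ^ 2 := by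
          refine (card_nearSet_le h2D (S := Finset.univ) fun κ hκ ↦ Finset.mem_univ _).trans ?_
          simp [ZMod.card, sq]
        have h2 : ((nearSet D h).card : ℝ) ≤ p ^ 2 := by exact_mod_cast h1
        linarith
  · push Not at hconst
    have hle := card_nearSet_le_of_lt_excCard h2D hconst
    have hle' : ((nearSet D h).card : ℝ) ≤ p := by exact_mod_cast hle
    rcases Nat.lt_or_ge 1 (nearSet D h).card with h1 | h1
    · obtain ⟨κ, hκ, κ', hκ', hne'⟩ := Finset.one_lt_card.1 h1
      have hne1 : κ.1 ≠ κ'.1 := fun heq ↦ hne' (eq_of_mem_nearSet h2D hκ hκ' heq)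
      right
      by_cases hex : ∀ κ ∈ nearSet D h, ∀ u, hyp κ.1 (h u) = κ.2
      · refine Or.inl ⟨κ, κ', hne1, fun u ↦ ?_, fun e ↦ (hcard e).trans (by linarith)⟩
        rw [hypInter, Finset.mem_filter]
        exact ⟨Finset.mem_univ _, hex κ hκ u, hex κ' hκ' u⟩
      · push Not at hex
        obtain ⟨κ₀, hκ₀, u, hu⟩ := hex
        refine Or.inr (Or.inl ⟨κ, κ', hne1, ?_, fun e ↦
          (hgain κ₀ hκ₀ u hu e).trans (by linarith)⟩)
        rw [mem_nearSet] at hκ hκ'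
        have hcover : (Finset.univ.filter fun u ↦ h u ∉ hypInter κ κ') ⊆
            (Finset.univ.filter fun u ↦ hyp κ.1 (h u) ≠ κ.2) ∪
            (Finset.univ.filter fun u ↦ hyp κ'.1 (h u) ≠ κ'.2) := by
          intro u hu
          simp only [hypInter, Finset.mem_filter, Finset.mem_univ, true_and,
            Finset.mem_union] at hu ⊢
          tauto
        have := (Finset.card_le_card hcover).trans (Finset.card_union_le _ _)
        rw [excCard]
        omega
    · left
      intro e
      have h2 : ((nearSet D h).card : ℝ) ≤ 1 := by exact_mod_cast h1
      exact (hcard e).trans (by linarith)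

lemma sum_le_sum_card_mul_of_cover {H I : Type*} [Fintype H] [Fintype I] (f : H → ℝ)
    (S : I → Finset H) (b : I → ℝ) (hb : ∀ i, 0 ≤ b i)
    (hcover : ∀ h, ∃ i, h ∈ S i ∧ f h ≤ b i) : ∑ h, f h ≤ ∑ i, (S i).card * b i := by
  classical
  calc ∑ h, f h ≤ ∑ h, ∑ i, if h ∈ S i then b i else 0 := by
        refine Finset.sum_le_sum fun h _ ↦ ?_
        obtain ⟨i, hi, hle⟩ := hcover h
        refine hle.trans ?_
        have := Finset.single_le_sum (f := fun i ↦ if h ∈ S i then b i else 0)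
          (fun i _ ↦ by split_ifs <;> simp [hb]) (Finset.mem_univ i)
        simpa [hi] using this
    _ = ∑ i, (S i).card * b i := by
        rw [Finset.sum_comm]
        refine Finset.sum_congr rfl fun i _ ↦ ?_
        simp

lemma prod_le_pow_mul_pow {L : Type*} [Fintype L] {d : L → ZMod p} {f : ZMod p → ℝ}
    (hf : ∀ e, 0 ≤ f e) {a b : ℝ} (ha : ∀ e, e ≠ 0 → f e ≤ a) (hb : f 0 ≤ b) :
    ∏ v, f (d v) ≤ b ^ (Finset.univ.filter fun v ↦ d v = 0).card *
      a ^ (Fintype.card L - (Finset.univ.filter fun v ↦ d v = 0).card) := by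
  classical
  have hcard : (Finset.univ.filter fun v ↦ ¬ d v = 0).card =
      Fintype.card L - (Finset.univ.filter fun v ↦ d v = 0).card := by
    have := Finset.card_filter_add_card_filter_not (s := Finset.univ) (fun v ↦ d v = 0)
    rw [Finset.card_univ] at this
    omega
  rw [← hcard, ← Finset.prod_filter_mul_prod_filter_not Finset.univ (fun v ↦ d v = 0),
    ← Finset.prod_const, ← Finset.prod_const]
  refine mul_le_mul (Finset.prod_le_prod (fun v _ ↦ hf _) fun v hv ↦ ?_)
    (Finset.prod_le_prod (fun v _ ↦ hf _) fun v hv ↦ ha _ (Finset.mem_filter.1 hv).2)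
    (Finset.prod_nonneg fun v _ ↦ hf _) (Finset.prod_nonneg fun v _ ↦ (hf 0).trans hb)
  rw [(Finset.mem_filter.1 hv).2]
  exact hb

end sum

section sum

variable {p : ℕ} [Fact p.Prime] {L R : Type*} [Fintype L] [Fintype R] [DecidableEq R] {q ρ : ℝ}

/-- The number of maps with few values outside `K`, compared with `|K| ^ |R|`. -/
lemma card_excCard_le_mul_le {K : Finset (ZMod p × ZMod p)} {κ D : ℕ} (hκ : 1 ≤ κ)
    (hK : K.card ≤ κ) {s y : ℝ} (hs0 : 0 < s) (hs1 : s ≤ 1) (hy : 0 ≤ y)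
    (hs : (1 + s * p ^ 2) ^ Fintype.card R * y ^ Fintype.card R ≤ s ^ D) :
    ((Finset.univ.filter fun h : R → ZMod p × ZMod p ↦ excCard K h ≤ D).card : ℝ) *
      y ^ Fintype.card R ≤ κ ^ Fintype.card R := by
  have h1 := card_excCard_le_mul_pow (R := R) K D hs0.le hs1
  have hT : (Fintype.card (ZMod p × ZMod p) : ℝ) = p ^ 2 := by
    rw [Fintype.card_prod, ZMod.card]
    push_cast
    ring
  have hK' : (K.card : ℝ) ≤ κ := by exact_mod_cast hK
  have hκ' : (1 : ℝ) ≤ κ := by exact_mod_cast hκ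
  have hsp : (0 : ℝ) ≤ s * p ^ 2 := by positivity
  have h2 : (K.card + s * Fintype.card (ZMod p × ZMod p) : ℝ) ^ Fintype.card R ≤
      κ ^ Fintype.card R * (1 + s * p ^ 2) ^ Fintype.card R := by
    rw [← mul_pow, hT]
    refine pow_le_pow_left₀ (by positivity) ?_ _
    nlinarith
  have h3 := mul_le_mul_of_nonneg_right (h1.trans h2) (pow_nonneg hy (Fintype.card R))
  have h4 : (κ : ℝ) ^ Fintype.card R * (1 + s * p ^ 2) ^ Fintype.card R * y ^ Fintype.card R ≤
      κ ^ Fintype.card R * s ^ D := by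
    rw [mul_assoc]
    exact mul_le_mul_of_nonneg_left hs (by positivity)
  refine le_of_mul_le_mul_right ?_ (pow_pos hs0 D)
  linarith

set_option synthInstance.maxSize 1000 in
/-- The expected size of the kernel given the degrees mod `p` of the vertices of `L`, up to
normalisation: apart from a constant, it is the lower bound provided by the vertices whose degree
is zero mod `p`. -/
theorem sum_prod_norm_vertexSum_le (hq0 : 0 ≤ q) (hq1 : q ≤ 1) (hρ0 : 0 < ρ) (hρ1 : ρ < 1)
    (hρ : ∀ t : ZMod p, t ≠ 0 → ‖bernoulliChar p q t‖ ≤ ρ) {D : ℕ} {s : ℝ} (hs0 : 0 < s)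
    (hs1 : s ≤ 1) (hD : p ^ 2 * D < Fintype.card R) (hLR : Fintype.card R ≤ Fintype.card L)
    (hτ : p ^ 3 * ρ ^ D ≤ (1 - ρ) / 2) (hτL : Fintype.card L * (p ^ 3 * ρ ^ D) ≤ 1)
    (hs : (1 + s * p ^ 2) ^ Fintype.card R * (1 - (1 - ρ) / (2 * p ^ 2)) ^ Fintype.card R ≤
      s ^ (p ^ 2 * D)) (d : L → ZMod p) :
    ∑ h : R → ZMod p × ZMod p, ∏ v, (p * ‖vertexSum p q (d v) h‖) ≤
      16 * p ^ 6 * (p : ℝ) ^ (Fintype.card L + (Fintype.card R +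
        ((Finset.univ.filter fun v ↦ d v = 0).card - Fintype.card R))) := by
  classical
  set n := Fintype.card L
  set r := Fintype.card R
  set Z := (Finset.univ.filter fun v ↦ d v = 0).card
  set τ : ℝ := p ^ 3 * ρ ^ D with hτdef
  set y : ℝ := 1 - (1 - ρ) / (2 * p ^ 2) with hydef
  have hp2 : (2 : ℝ) ≤ p := by exact_mod_cast (Fact.out : p.Prime).two_le
  have hp1 : (1 : ℝ) ≤ p := by linarith
  have hp1' : 1 ≤ p := (Fact.out : p.Prime).one_le
  have hτ0 : 0 ≤ τ := by positivity
  have hZn : Z ≤ n := Finset.card_le_univ _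
  have hη : (1 - ρ) / (2 * p ^ 2) * p ^ 2 = (1 - ρ) / 2 := by field_simp
  have hη0 : 0 ≤ (1 - ρ) / (2 * (p : ℝ) ^ 2) := div_nonneg (by linarith) (by positivity)
  have hη1 : (1 - ρ) / (2 * (p : ℝ) ^ 2) ≤ 1 / 2 := by nlinarith
  have hy0 : 0 ≤ y := by linarith
  have hy1 : y ≤ 1 := by linarith
  have hpy : 1 ≤ p * y := by nlinarith
  have hτn : (1 + τ) ^ n ≤ 3 := by
    have h1 : (1 + τ) ^ n ≤ Real.exp τ ^ n :=
      pow_le_pow_left₀ (by positivity) (by linarith [Real.add_one_le_exp τ]) n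
    rw [← Real.exp_nat_mul] at h1
    have h2 := Real.exp_le_exp.2 hτL
    linarith [Real.exp_one_lt_d9]
  set T : ℝ := (p : ℝ) ^ (n + (r + (Z - r)))
  have hT0 : 0 ≤ T := by positivity
  have hTpow : ∀ k, k ≤ n + (r + (Z - r)) → (p : ℝ) ^ k ≤ T := fun k hk ↦
    pow_le_pow_right₀ hp1 hk
  have hP : (Fintype.card (Hyperbola p × Hyperbola p) : ℝ) = p ^ 6 := by
    simp only [Fintype.card_prod, ZMod.card]
    push_cast
    ring
  have hF : (Fintype.card (ZMod p × ZMod p) : ℝ) = p ^ 2 := by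
    simp only [Fintype.card_prod, ZMod.card]
    push_cast
    ring
  -- A cover of the set of all `h`, with one part for each of the five cases of `vertexSum_cases`
  -- and each choice of the hyperbolas or of the point; `b` bounds the summand on each part.
  set S : Unit ⊕ (Hyperbola p × Hyperbola p) ⊕ (Hyperbola p × Hyperbola p) ⊕
      (ZMod p × ZMod p) ⊕ (ZMod p × ZMod p) → Finset (R → ZMod p × ZMod p) :=
    Sum.elim (fun _ ↦ Finset.univ) <|
    Sum.elim (fun κ ↦ Finset.univ.filter fun h ↦
      κ.1.1 ≠ κ.2.1 ∧ ∀ u, h u ∈ hypInter κ.1 κ.2) <|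
    Sum.elim (fun κ ↦ Finset.univ.filter fun h ↦
      κ.1.1 ≠ κ.2.1 ∧ excCard (hypInter κ.1 κ.2) h ≤ p ^ 2 * D) <|
    Sum.elim (fun z ↦ Finset.univ.filter fun h ↦ ∀ u, h u = z)
      (fun z ↦ Finset.univ.filter fun h ↦ excCard {z} h ≤ p ^ 2 * D) with hS
  set b : Unit ⊕ (Hyperbola p × Hyperbola p) ⊕ (Hyperbola p × Hyperbola p) ⊕
      (ZMod p × ZMod p) ⊕ (ZMod p × ZMod p) → ℝ :=
    Sum.elim (fun _ ↦ (1 + τ) ^ n) <|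
    Sum.elim (fun κ ↦ (p * (1 + τ)) ^ n) <|
    Sum.elim (fun κ ↦ (p * y) ^ n) <|
    Sum.elim (fun z ↦ (p ^ 2 * (1 + τ)) ^ Z * (p * (1 + τ)) ^ (n - Z))
      (fun z ↦ (p ^ 2 * y) ^ Z * (p * (1 + τ)) ^ (n - Z)) with hb
  have hb0 : ∀ i, 0 ≤ b i := by
    rintro (_ | _ | _ | _ | _) <;>
    · simp only [hb, Sum.elim_inl, Sum.elim_inr]
      positivity
  have hcover : ∀ h, ∃ i, h ∈ S i ∧ ∏ v, (p * ‖vertexSum p q (d v) h‖) ≤ b i := by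
    intro h
    have hf0 : ∀ e, 0 ≤ p * ‖vertexSum p q e h‖ := fun e ↦ by positivity
    have hprod : ∀ c, (∀ e, p * ‖vertexSum p q e h‖ ≤ c) →
        ∏ v, (p * ‖vertexSum p q (d v) h‖) ≤ c ^ n := fun c hc ↦
      (Finset.prod_le_prod (fun v _ ↦ hf0 _) fun v _ ↦ hc _).trans
        (by rw [Finset.prod_const, Finset.card_univ])
    rcases vertexSum_cases hq0 hq1 hρ0.le hρ1.le hρ hD h (fun _ ↦ rfl) hτdef with
      h1 | ⟨κ, κ', hne, hK, h1⟩ | ⟨κ, κ', hne, hK, h1⟩ | ⟨z, hz, h1, h2⟩ | ⟨z, hz, h1, h2⟩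
    · exact ⟨Sum.inl (), by simp [hS], hprod _ h1⟩
    · refine ⟨Sum.inr (Sum.inl (κ, κ')), by simpa [hS] using ⟨hne, hK⟩, hprod _ fun e ↦ ?_⟩
      refine (h1 e).trans ?_
      nlinarith
    · refine ⟨Sum.inr (Sum.inr (Sum.inl (κ, κ'))), by simpa [hS] using ⟨hne, hK⟩,
        hprod _ fun e ↦ (h1 e).trans ?_⟩
      nlinarith
    · exact ⟨Sum.inr (Sum.inr (Sum.inr (Sum.inl z))), by simpa [hS] using hz,
        prod_le_pow_mul_pow hf0 h1 h2⟩
    · exact ⟨Sum.inr (Sum.inr (Sum.inr (Sum.inr z))), by simpa [hS] using hz,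
        prod_le_pow_mul_pow hf0 h1 (h2.trans (by nlinarith))⟩
  refine (sum_le_sum_card_mul_of_cover _ S b hb0 hcover).trans ?_
  simp only [Fintype.sum_sum_type, hS, hb, Sum.elim_inl, Sum.elim_inr]
  have hA : ∑ _ : Unit, ((Finset.univ : Finset (R → ZMod p × ZMod p)).card : ℝ) *
      (1 + τ) ^ n ≤ 3 * T := by
    have h1 : ((Finset.univ : Finset (R → ZMod p × ZMod p)).card : ℝ) = p ^ (r + r) := by
      rw [Finset.card_univ, Fintype.card_fun, Nat.cast_pow, hF]
      ring
    rw [Fintype.sum_unique, h1, mul_comm]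
    -- Here `|R| ≤ |L|` is needed: all `p ^ (2 |R|)` functions `h` are counted.
    exact mul_le_mul hτn (hTpow _ (by omega)) (by positivity) (by norm_num)
  have hB : ∑ κ : Hyperbola p × Hyperbola p, ((Finset.univ.filter fun h : R → ZMod p × ZMod p ↦
      κ.1.1 ≠ κ.2.1 ∧ ∀ u, h u ∈ hypInter κ.1 κ.2).card : ℝ) * (p * (1 + τ)) ^ n ≤
      3 * p ^ 6 * T := by
    refine (Finset.sum_le_card_nsmul _ _ (3 * T) fun κ _ ↦ ?_).trans ?_
    · have h1 : ((Finset.univ.filter fun h : R → ZMod p × ZMod p ↦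
          κ.1.1 ≠ κ.2.1 ∧ ∀ u, h u ∈ hypInter κ.1 κ.2).card : ℝ) ≤ p ^ r := by
        by_cases hne : κ.1.1 = κ.2.1
        · simp [hne]
        · have h2 : (Finset.univ.filter fun h : R → ZMod p × ZMod p ↦
              κ.1.1 ≠ κ.2.1 ∧ ∀ u, h u ∈ hypInter κ.1 κ.2) =
              Fintype.piFinset fun _ ↦ hypInter κ.1 κ.2 := by
            ext h
            simp [hne]
          rw [h2, Fintype.card_piFinset, Finset.prod_const, Finset.card_univ]
          exact_mod_cast Nat.pow_le_pow_left (card_hypInter_le hne) r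
      have h3 : (p : ℝ) ^ r * (p : ℝ) ^ n ≤ T := by
        rw [← pow_add]
        exact hTpow _ (by omega)
      calc _ ≤ (p : ℝ) ^ r * (p * (1 + τ)) ^ n :=
            mul_le_mul_of_nonneg_right h1 (by positivity)
        _ = (1 + τ) ^ n * ((p : ℝ) ^ r * (p : ℝ) ^ n) := by
            rw [mul_pow]
            ring
        _ ≤ 3 * T := mul_le_mul hτn h3 (by positivity) (by norm_num)
    · rw [Finset.card_univ, nsmul_eq_mul, hP]
      exact le_of_eq (by ring)
  have hC : ∑ κ : Hyperbola p × Hyperbola p, ((Finset.univ.filter fun h : R → ZMod p × ZMod p ↦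
      κ.1.1 ≠ κ.2.1 ∧ excCard (hypInter κ.1 κ.2) h ≤ p ^ 2 * D).card : ℝ) * (p * y) ^ n ≤
      p ^ 6 * T := by
    refine (Finset.sum_le_card_nsmul _ _ T fun κ _ ↦ ?_).trans ?_
    · by_cases hne : κ.1.1 = κ.2.1
      · simpa [hne] using hT0
      · simp only [ne_eq, hne, not_false_eq_true, true_and]
        have h1 := card_excCard_le_mul_le (R := R) (D := p ^ 2 * D) hp1' (card_hypInter_le hne)
          hs0 hs1 hy0 hs
        -- The gain `y` at each vertex pays for the exceptional values.
        have h2 : y ^ n ≤ y ^ r := pow_le_pow_of_le_one hy0 hy1 hLR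
        calc _ ≤ ((Finset.univ.filter fun h : R → ZMod p × ZMod p ↦
              excCard (hypInter κ.1 κ.2) h ≤ p ^ 2 * D).card : ℝ) * (p ^ n * y ^ r) := by
              rw [mul_pow]
              exact mul_le_mul_of_nonneg_left (mul_le_mul_of_nonneg_left h2 (by positivity))
                (by positivity)
          _ ≤ (p : ℝ) ^ r * p ^ n := by
              rw [mul_left_comm, mul_comm]
              exact mul_le_mul_of_nonneg_right h1 (by positivity)
          _ ≤ T := by
              rw [← pow_add]
              exact hTpow _ (by omega)
    · rw [Finset.card_univ, nsmul_eq_mul, hP]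
  have hDE : ∀ x : ℝ, 0 ≤ x → (p ^ 2 * x) ^ Z * (p * (1 + τ)) ^ (n - Z) ≤
      3 * p ^ n * (p ^ Z * x ^ Z) := by
    intro x hx
    have h1 : (1 + τ) ^ (n - Z) ≤ 3 :=
      (pow_le_pow_right₀ (by linarith) (Nat.sub_le n Z)).trans hτn
    have h2 : (p : ℝ) ^ n = p ^ Z * p ^ (n - Z) := by
      rw [← pow_add]
      congr 1
      omega
    calc (p ^ 2 * x) ^ Z * (p * (1 + τ)) ^ (n - Z) =
          (1 + τ) ^ (n - Z) * (p ^ n * (p ^ Z * x ^ Z)) := by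
          rw [h2, mul_pow, mul_pow]
          ring
      _ ≤ 3 * (p ^ n * (p ^ Z * x ^ Z)) := mul_le_mul_of_nonneg_right h1 (by positivity)
      _ = _ := by ring
  have hD' : ∑ z : ZMod p × ZMod p, ((Finset.univ.filter fun h : R → ZMod p × ZMod p ↦
      ∀ u, h u = z).card : ℝ) * ((p ^ 2 * (1 + τ)) ^ Z * (p * (1 + τ)) ^ (n - Z)) ≤
      3 * p ^ 2 * T := by
    refine (Finset.sum_le_card_nsmul _ _ (3 * T) fun z _ ↦ ?_).trans ?_
    · have h1 : ((Finset.univ.filter fun h : R → ZMod p × ZMod p ↦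
          ∀ u, h u = z).card : ℝ) ≤ 1 := by
        have : (Finset.univ.filter fun h : R → ZMod p × ZMod p ↦ ∀ u, h u = z).card ≤ 1 := by
          refine Finset.card_le_one.2 fun h hh h' hh' ↦ ?_
          ext1 u
          rw [(Finset.mem_filter.1 hh).2 u, (Finset.mem_filter.1 hh').2 u]
        exact_mod_cast this
      have h2 : (p ^ 2 * (1 + τ)) ^ Z * (p * (1 + τ)) ^ (n - Z) =
          (1 + τ) ^ n * ((p : ℝ) ^ (n + Z)) := by
        have e1 : (1 + τ) ^ n = (1 + τ) ^ Z * (1 + τ) ^ (n - Z) := by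
          rw [← pow_add]
          congr 1
          omega
        have e2 : (p : ℝ) ^ (n + Z) = p ^ Z * p ^ Z * p ^ (n - Z) := by
          rw [← pow_add, ← pow_add]
          congr 1
          omega
        rw [e1, e2, mul_pow, mul_pow]
        ring
      rw [h2]
      calc _ ≤ 1 * ((1 + τ) ^ n * ((p : ℝ) ^ (n + Z))) :=
            mul_le_mul_of_nonneg_right h1 (by positivity)
        _ ≤ 3 * T := by
            rw [one_mul]
            exact mul_le_mul hτn (hTpow _ (by omega)) (by positivity) (by norm_num)
    · rw [Finset.card_univ, nsmul_eq_mul, hF]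
      exact le_of_eq (by ring)
  have hE : ∑ z : ZMod p × ZMod p, ((Finset.univ.filter fun h : R → ZMod p × ZMod p ↦
      excCard {z} h ≤ p ^ 2 * D).card : ℝ) * ((p ^ 2 * y) ^ Z * (p * (1 + τ)) ^ (n - Z)) ≤
      3 * p ^ 2 * T := by
    refine (Finset.sum_le_card_nsmul _ _ (3 * T) fun z _ ↦ ?_).trans ?_
    · have h1 := card_excCard_le_mul_le (R := R) (K := {z}) (D := p ^ 2 * D) le_rfl
        (Finset.card_singleton z).le hs0 hs1 hy0 hs
      rw [Nat.cast_one, one_pow] at h1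
      -- As `1 ≤ p y`, replacing the exponent `Z` by `r` costs at most `p ^ (Z - r)`.
      have h2 : (p : ℝ) ^ Z * y ^ Z ≤ p ^ (r + (Z - r)) * y ^ r := by
        rcases le_total r Z with hrZ | hrZ
        · rw [Nat.add_sub_cancel' hrZ]
          exact mul_le_mul_of_nonneg_left (pow_le_pow_of_le_one hy0 hy1 hrZ) (by positivity)
        · rw [Nat.sub_eq_zero_of_le hrZ, add_zero, ← mul_pow, ← mul_pow]
          exact pow_le_pow_right₀ hpy hrZ
      calc _ ≤ ((Finset.univ.filter fun h : R → ZMod p × ZMod p ↦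
            excCard {z} h ≤ p ^ 2 * D).card : ℝ) *
              (3 * p ^ n * (p ^ (r + (Z - r)) * y ^ r)) :=
            mul_le_mul_of_nonneg_left ((hDE y hy0).trans
              (mul_le_mul_of_nonneg_left h2 (by positivity))) (by positivity)
        _ = ((Finset.univ.filter fun h : R → ZMod p × ZMod p ↦
            excCard {z} h ≤ p ^ 2 * D).card : ℝ) * y ^ r * (3 * T) := by
            simp only [T, pow_add]
            ring
        _ ≤ 3 * T := by
            have := mul_le_mul_of_nonneg_right h1 (by positivity : 0 ≤ 3 * T)
            simpa using this
    · rw [Finset.card_univ, nsmul_eq_mul, hF]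
      exact le_of_eq (by ring)
  have hp26 : (p : ℝ) ^ 2 ≤ p ^ 6 := pow_le_pow_right₀ hp1 (by norm_num)
  have hp06 : (1 : ℝ) ≤ p ^ 6 := one_le_pow₀ hp1
  nlinarith

end sum

/-! ### The first moment of the size of the kernel -/

section expectation

variable {p : ℕ} [Fact p.Prime] {q ρ : ℝ}

/-- For large `n` there are parameters for which the bound on the contributions holds. -/
lemma exists_parameters (p : ℕ) [Fact p.Prime] {ρ : ℝ} (hρ0 : 0 < ρ) (hρ1 : ρ < 1) {α : ℝ}
    (hα : 0 < α) : ∃ N : ℕ, ∀ n : ℕ, N ≤ n → ∃ (D : ℕ) (s : ℝ), 0 < s ∧ s ≤ 1 ∧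
      p ^ 2 * D < ⌊α * n⌋₊ ∧ p ^ 3 * ρ ^ D ≤ (1 - ρ) / 2 ∧ n * (p ^ 3 * ρ ^ D) ≤ 1 ∧
      (1 + s * p ^ 2) ^ ⌊α * n⌋₊ * (1 - (1 - ρ) / (2 * p ^ 2)) ^ ⌊α * n⌋₊ ≤
        s ^ (p ^ 2 * D) := by
  have hp2 : (2 : ℝ) ≤ p := by exact_mod_cast (Fact.out : p.Prime).two_le
  set η : ℝ := (1 - ρ) / (2 * p ^ 2) with hη
  have hη0 : 0 < η := div_pos (by linarith) (by positivity)
  have hη1 : η ≤ 1 / 2 := by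
    rw [hη, div_le_iff₀ (by positivity)]
    nlinarith
  -- The choice of `s` keeps `(1 + s p²) (1 - η)` below `1 - η / 2`.
  set s : ℝ := η / (2 * p ^ 2) with hs
  have hs0 : 0 < s := by positivity
  have hsp : s * p ^ 2 = η / 2 := by rw [hs]; field_simp
  have hs1 : s ≤ 1 := by nlinarith
  set y : ℝ := 1 - η / 2 with hy
  have hy0 : 0 < y := by linarith
  have hy1 : y < 1 := by linarith
  have hbase : (1 + s * p ^ 2) * (1 - η) ≤ y := by
    rw [hsp]
    nlinarith
  -- With `D = ⌊α n⌋ / k`, the gain `y` at `k` vertices of `R` pays for `p²` exceptional values.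
  obtain ⟨k₀, hk₀⟩ := exists_pow_lt_of_lt_one (pow_pos hs0 (p ^ 2)) hy1
  set k := max k₀ (p ^ 2 + 1)
  have hk : y ^ k ≤ s ^ p ^ 2 :=
    (pow_le_pow_of_le_one hy0.le hy1.le (le_max_left _ _)).trans hk₀.le
  have hkp : p ^ 2 < k := lt_of_lt_of_le (Nat.lt_succ_self _) (le_max_right _ _)
  have hk0 : 0 < k := by omega
  set A : ℝ := (k + 1) / α
  have hA : 0 < A := by positivity
  have hnD : ∀ n : ℕ, (n : ℝ) ≤ A * ((⌊α * n⌋₊ / k : ℕ) + 1) := by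
    intro n
    have h1 : α * n < ⌊α * n⌋₊ + 1 := Nat.lt_floor_add_one _
    have h2 : ((⌊α * n⌋₊ : ℕ) : ℝ) + 1 ≤ k * ((⌊α * n⌋₊ / k : ℕ) + 1) := by
      exact_mod_cast Nat.lt_mul_div_succ _ hk0
    have h3 : (0 : ℝ) ≤ (⌊α * n⌋₊ / k : ℕ) := by positivity
    rw [div_mul_eq_mul_div, le_div_iff₀ hα]
    nlinarith
  have hlim : Filter.Tendsto (fun n : ℕ ↦ ⌊α * n⌋₊ / k) Filter.atTop Filter.atTop := by
    rw [Filter.tendsto_atTop]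
    intro b
    obtain ⟨N, hN⟩ := exists_nat_ge (A * (b + 1))
    filter_upwards [Filter.eventually_gt_atTop N] with n hn
    have h1 := hnD n
    have h2 : A * ((b : ℝ) + 1) < A * ((⌊α * n⌋₊ / k : ℕ) + 1) :=
      lt_of_le_of_lt hN (lt_of_lt_of_le (by exact_mod_cast hn) h1)
    have h3 := lt_of_mul_lt_mul_left h2 hA.le
    have h4 : b + 1 < ⌊α * n⌋₊ / k + 1 := by exact_mod_cast h3
    omega
  have hτ0 : Filter.Tendsto (fun D : ℕ ↦ (p : ℝ) ^ 3 * ρ ^ D) Filter.atTop (nhds 0) := by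
    simpa using (tendsto_pow_atTop_nhds_zero_of_lt_one hρ0.le hρ1).const_mul ((p : ℝ) ^ 3)
  have hτ1 : Filter.Tendsto (fun D : ℕ ↦ A * ((D : ℝ) + 1) * ((p : ℝ) ^ 3 * ρ ^ D))
      Filter.atTop (nhds 0) := by
    have h1 := (tendsto_self_mul_const_pow_of_lt_one hρ0.le hρ1).add
      (tendsto_pow_atTop_nhds_zero_of_lt_one hρ0.le hρ1)
    have h2 := h1.const_mul (A * (p : ℝ) ^ 3)
    rw [add_zero, mul_zero] at h2
    refine h2.congr fun D ↦ ?_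
    ring
  have hev := ((hlim.eventually (hτ0.eventually (gt_mem_nhds
    (show (0 : ℝ) < (1 - ρ) / 2 by linarith)))).and
    (hlim.eventually (hτ1.eventually (gt_mem_nhds (zero_lt_one (α := ℝ)))))).and
    (hlim.eventually (Filter.eventually_gt_atTop 0))
  obtain ⟨N, hN⟩ := Filter.eventually_atTop.1 hev
  refine ⟨N, fun n hn ↦ ?_⟩
  obtain ⟨⟨h1, h2⟩, h3⟩ := hN n hn
  have hle : k * (⌊α * n⌋₊ / k) ≤ ⌊α * n⌋₊ := Nat.mul_div_le _ _
  refine ⟨⌊α * n⌋₊ / k, s, hs0, hs1, ?_, h1.le, ?_, ?_⟩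
  · exact lt_of_lt_of_le (Nat.mul_lt_mul_of_pos_right hkp h3) hle
  · exact (mul_le_mul_of_nonneg_right (hnD n) (by positivity)).trans h2.le
  · rw [← mul_pow]
    have h4 : 0 ≤ (1 + s * p ^ 2) * (1 - η) := mul_nonneg (by positivity) (by linarith)
    calc ((1 + s * p ^ 2) * (1 - η)) ^ ⌊α * n⌋₊ ≤ y ^ ⌊α * n⌋₊ := pow_le_pow_left₀ h4 hbase _
      _ ≤ y ^ (k * (⌊α * n⌋₊ / k)) := pow_le_pow_of_le_one hy0.le hy1.le hle
      _ = (y ^ k) ^ (⌊α * n⌋₊ / k) := pow_mul _ _ _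
      _ ≤ (s ^ p ^ 2) ^ (⌊α * n⌋₊ / k) := pow_le_pow_left₀ (by positivity) hk _
      _ = s ^ (p ^ 2 * (⌊α * n⌋₊ / k)) := (pow_mul _ _ _).symm

lemma sum_prod_eq_prod_sum {L T : Type*} [Fintype L] [DecidableEq L] [Fintype T] (f : L → T → ℝ) :
    ∑ M : L → T, ∏ v, f v (M v) = ∏ v, ∑ m, f v m := by
  have h1 := Finset.prod_univ_sum (fun _ : L ↦ (Finset.univ : Finset T)) f
  rw [Fintype.piFinset_univ] at h1
  exact h1.symm

variable {L R : Type*} [Fintype L] [Fintype R]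

/-- The probability of the `0`-`1` matrix `M` when the entries are independent and equal to `1`
with probability `q`. -/
def matWeight (q : ℝ) (M : L → R → Bool) : ℝ := ∏ v, rowWeight q (M v)

lemma matWeight_nonneg (hq0 : 0 ≤ q) (hq1 : q ≤ 1) (M : L → R → Bool) : 0 ≤ matWeight q M :=
  Finset.prod_nonneg fun _ _ ↦ rowWeight_nonneg hq0 hq1 _

variable [DecidableEq L] [DecidableEq R]

lemma sum_matWeight (p : ℕ) [Fact p.Prime] (q : ℝ) :
    ∑ M : L → R → Bool, matWeight q M = 1 := by
  simp only [matWeight]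
  rw [sum_prod_eq_prod_sum fun _ m ↦ rowWeight q m]
  simp [sum_rowWeight p]

/-- The number of vertices of `L` of degree zero mod `p`. -/
def zeroCount {p : ℕ} (d : L → ZMod p) : ℕ := (Finset.univ.filter fun v ↦ d v = 0).card

/-- The first moment of the size of the kernel, on the event that the degrees mod `p` are `d`. -/
lemma sum_matWeight_mul_pow_finrank_le (hq0 : 0 ≤ q) (hq1 : q ≤ 1) (hρ0 : 0 < ρ) (hρ1 : ρ < 1)
    (hρ : ∀ t : ZMod p, t ≠ 0 → ‖bernoulliChar p q t‖ ≤ ρ) {D : ℕ} {s : ℝ} (hs0 : 0 < s)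
    (hs1 : s ≤ 1) (hD : p ^ 2 * D < Fintype.card R) (hLR : Fintype.card R ≤ Fintype.card L)
    (hτ : p ^ 3 * ρ ^ D ≤ (1 - ρ) / 2) (hτL : Fintype.card L * (p ^ 3 * ρ ^ D) ≤ 1)
    (hs : (1 + s * p ^ 2) ^ Fintype.card R * (1 - (1 - ρ) / (2 * p ^ 2)) ^ Fintype.card R ≤
      s ^ (p ^ 2 * D)) (d : L → ZMod p) :
    ∑ M : L → R → Bool, matWeight q M * (if (fun v ↦ rowDeg p (M v)) = d then 1 else 0) *
        (p : ℝ) ^ Module.finrank (ZMod p) ((matrixGraph M).lapKer p) ≤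
      16 * p ^ 6 * p ^ (zeroCount d - Fintype.card R) * ((p : ℝ) ^ Fintype.card L)⁻¹ := by
  have hp0 : (0 : ℝ) < p := by exact_mod_cast (Fact.out : p.Prime).pos
  set W := ∑ M : L → R → Bool, matWeight q M *
    (if (fun v ↦ rowDeg p (M v)) = d then 1 else 0) *
        (p : ℝ) ^ Module.finrank (ZMod p) ((matrixGraph M).lapKer p) with hW
  have h1 := sum_pow_finrank_lapKer (R := R) p q d
  have h2 : ((p ^ (Fintype.card L + Fintype.card R) * W : ℝ) : ℂ) =
      ∑ h : R → ZMod p × ZMod p, ∏ v, vertexSum p q (d v) h := by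
    rw [← h1, hW]
    push_cast
    congr 1
    refine Finset.sum_congr rfl fun M _ ↦ ?_
    simp only [matWeight, funext_iff]
    push_cast
    congr 2
    split_ifs <;> simp
  have h3 : (p : ℝ) ^ (Fintype.card L + Fintype.card R) * W ≤
      ∑ h : R → ZMod p × ZMod p, ∏ v, ‖vertexSum p q (d v) h‖ := by
    refine (le_abs_self _).trans ?_
    rw [← Real.norm_eq_abs, ← Complex.norm_real, h2]
    refine (norm_sum_le _ _).trans (le_of_eq ?_)
    simp only [norm_prod]
  have h4 := sum_prod_norm_vertexSum_le hq0 hq1 hρ0 hρ1 hρ hs0 hs1 hD hLR hτ hτL hs d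
  simp only [Finset.prod_mul_distrib, Finset.prod_const, Finset.card_univ] at h4
  rw [← Finset.mul_sum] at h4
  have h5 := (mul_le_mul_of_nonneg_left h3 (by positivity : 0 ≤ (p : ℝ) ^ Fintype.card L)).trans h4
  rw [← div_eq_mul_inv, le_div_iff₀ (by positivity)]
  refine le_of_mul_le_mul_left ?_
    (by positivity : 0 < (p : ℝ) ^ (Fintype.card L + Fintype.card R))
  rw [zeroCount]
  rw [← add_assoc, pow_add _ (Fintype.card L + Fintype.card R)] at h5
  linarith

/-- The corank of the laplacian exceeds the lower bound `zeroCount - |R|` by a quantity with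
a bounded exponential moment. -/
lemma sum_matWeight_mul_pow_sub_le {B : ℝ}
    (hB : ∀ d : L → ZMod p, ∑ M : L → R → Bool, matWeight q M *
      (if (fun v ↦ rowDeg p (M v)) = d then 1 else 0) *
        (p : ℝ) ^ Module.finrank (ZMod p) ((matrixGraph M).lapKer p) ≤
      B * p ^ (zeroCount d - Fintype.card R) * ((p : ℝ) ^ Fintype.card L)⁻¹) :
    ∑ M : L → R → Bool, matWeight q M *
        (p : ℝ) ^ (Module.finrank (ZMod p) ((matrixGraph M).lapKer p) -
          (zeroCount (fun v ↦ rowDeg p (M v)) - Fintype.card R)) ≤ B := by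
  have hp0 : (0 : ℝ) < p := by exact_mod_cast (Fact.out : p.Prime).pos
  calc _ = ∑ d : L → ZMod p, (∑ M : L → R → Bool, matWeight q M *
        (if (fun v ↦ rowDeg p (M v)) = d then 1 else 0) *
        (p : ℝ) ^ Module.finrank (ZMod p) ((matrixGraph M).lapKer p)) *
        ((p : ℝ) ^ (zeroCount d - Fintype.card R))⁻¹ := by
        simp only [Finset.sum_mul]
        rw [Finset.sum_comm]
        refine Finset.sum_congr rfl fun M _ ↦ ?_
        rw [Finset.sum_eq_single (fun v ↦ rowDeg p (M v))]
        · have h1 : zeroCount (fun v ↦ rowDeg p (M v)) - Fintype.card R ≤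
              Module.finrank (ZMod p) ((matrixGraph M).lapKer p) := by
            have := card_rowDeg_eq_zero_le p M
            rw [zeroCount]
            omega
          rw [pow_sub₀ _ hp0.ne' h1]
          simp [mul_assoc]
        · intro d _ hd
          rw [if_neg hd.symm]
          ring
        · simp
    _ ≤ ∑ d : L → ZMod p, B * ((p : ℝ) ^ Fintype.card L)⁻¹ := by
        refine Finset.sum_le_sum fun d _ ↦ ?_
        rw [← div_eq_mul_inv, div_le_iff₀ (by positivity)]
        refine (hB d).trans (le_of_eq (by ring))
    _ = B := by
        rw [Finset.sum_const, Finset.card_univ, Fintype.card_fun, ZMod.card, nsmul_eq_mul]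
        push_cast
        field_simp

lemma sum_matWeight_rowDeg_eq {p : ℕ} (q : ℝ) (d : L → ZMod p) :
    ∑ M : L → R → Bool, matWeight q M * (if (fun v ↦ rowDeg p (M v)) = d then 1 else 0) =
      ∏ v, rowProb R q (d v) := by
  simp only [rowProb]
  rw [← sum_prod_eq_prod_sum fun v m ↦ rowWeight q m * if rowDeg p m = d v then 1 else 0]
  refine Finset.sum_congr rfl fun M _ ↦ ?_
  rw [Finset.prod_mul_distrib, matWeight, Finset.prod_ite_zero]
  simp [funext_iff]

/-- The degrees mod `p` of the vertices of `L` are jointly almost uniform. -/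
lemma sum_abs_prod_rowProb_sub_le (hρ0 : 0 ≤ ρ)
    (hρ : ∀ t : ZMod p, t ≠ 0 → ‖bernoulliChar p q t‖ ≤ ρ) :
    ∑ d : L → ZMod p, |∏ v, rowProb R q (d v) - ((p : ℝ) ^ Fintype.card L)⁻¹| ≤
      Real.exp (Fintype.card L * (p * ρ ^ Fintype.card R)) - 1 := by
  have hp0 : (0 : ℝ) < p := by exact_mod_cast (Fact.out : p.Prime).pos
  have h1 : ∀ d : L → ZMod p, |∏ v, rowProb R q (d v) - ((p : ℝ) ^ Fintype.card L)⁻¹| ≤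
      ((p : ℝ) ^ Fintype.card L)⁻¹ *
        (Real.exp (Fintype.card L * (p * ρ ^ Fintype.card R)) - 1) := by
    intro d
    have h2 : ∏ v, rowProb R q (d v) - ((p : ℝ) ^ Fintype.card L)⁻¹ =
        ((p : ℝ) ^ Fintype.card L)⁻¹ * (∏ v, (1 + (p * rowProb R q (d v) - 1)) - 1) := by
      simp only [add_sub_cancel, Finset.prod_mul_distrib, Finset.prod_const, Finset.card_univ]
      field_simp
    rw [h2, abs_mul, abs_of_nonneg (by positivity : 0 ≤ ((p : ℝ) ^ Fintype.card L)⁻¹)]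
    refine mul_le_mul_of_nonneg_left ?_ (by positivity)
    have h3 := Finset.norm_prod_one_add_sub_one_le Finset.univ
      (fun v ↦ p * rowProb R q (d v) - 1)
    rw [Real.norm_eq_abs] at h3
    refine h3.trans (sub_le_sub_right (Real.exp_le_exp.2 ?_) 1)
    refine (Finset.sum_le_card_nsmul _ _ (p * ρ ^ Fintype.card R) fun v _ ↦ ?_).trans ?_
    · exact abs_rowProb_sub_le hρ0 hρ _
    · rw [nsmul_eq_mul, Finset.card_univ]
  refine (Finset.sum_le_sum fun d _ ↦ h1 d).trans (le_of_eq ?_)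
  rw [Finset.sum_const, Finset.card_univ, Fintype.card_fun, ZMod.card, nsmul_eq_mul]
  push_cast
  field_simp

end expectation

/-! ### Coupling -/

/-- A maximal coupling of the law of `f` under the weights `P` with the weights `τ`, glued to `P`
along `f`. -/
lemma exists_coupling {S T : Type*} [Fintype S] [Fintype T] [DecidableEq T] {P : S → ℝ}
    {τ : T → ℝ} (f : S → T) (hP : ∀ s, 0 ≤ P s) (hτ : ∀ t, 0 ≤ τ t) (hP1 : ∑ s, P s = 1)
    (hτ1 : ∑ t, τ t = 1) :
    ∃ J : S → T → ℝ, (∀ s t, 0 ≤ J s t) ∧ (∀ s, ∑ t, J s t = P s) ∧ (∀ t, ∑ s, J s t = τ t) ∧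
      ∑ s, ∑ t, (if f s ≠ t then J s t else 0) ≤
        ∑ t, |∑ s, (P s * if f s = t then 1 else 0) - τ t| := by
  set Q : T → ℝ := fun t ↦ ∑ s, P s * if f s = t then 1 else 0
  have hQ : ∀ t, 0 ≤ Q t := fun t ↦
    Finset.sum_nonneg fun s _ ↦ mul_nonneg (hP s) (by split_ifs <;> norm_num)
  have hPQ : ∀ s, P s ≤ Q (f s) := by
    intro s
    have := Finset.single_le_sum (f := fun s' ↦ P s' * if f s' = f s then 1 else 0)
      (fun s' _ ↦ mul_nonneg (hP s') (by split_ifs <;> norm_num)) (Finset.mem_univ s)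
    simpa [Q] using this
  have hsumQ : ∀ g : T → ℝ, ∑ s, P s * g (f s) = ∑ t, Q t * g t := by
    intro g
    simp only [Q, Finset.sum_mul]
    rw [Finset.sum_comm]
    refine Finset.sum_congr rfl fun s _ ↦ ?_
    rw [Finset.sum_eq_single (f s)]
    · simp
    · intro t _ ht
      simp [ht.symm]
    · simp
  -- The common part `min Q τ` goes to the diagonal, the excesses `a` and `b` are made independent;
  -- if they vanish, then `δ = 0` and the division by `δ` is harmless.
  set a : T → ℝ := fun t ↦ Q t - min (Q t) (τ t)
  set b : T → ℝ := fun t ↦ τ t - min (Q t) (τ t)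
  have ha : ∀ t, 0 ≤ a t := fun t ↦ sub_nonneg.2 (min_le_left _ _)
  have hb : ∀ t, 0 ≤ b t := fun t ↦ sub_nonneg.2 (min_le_right _ _)
  set δ := ∑ t, a t
  have hQ1 : ∑ t, Q t = 1 := by
    have := hsumQ fun _ ↦ 1
    simpa [hP1] using this.symm
  have hδ : ∑ t, b t = δ := by
    simp only [δ, a, b, Finset.sum_sub_distrib, hQ1, hτ1]
  have hδ0 : 0 ≤ δ := Finset.sum_nonneg fun t _ ↦ ha t
  have hca : ∀ t, a t * (δ / δ) = a t := by
    intro t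
    rcases eq_or_ne δ 0 with h | h
    · rw [(Finset.sum_eq_zero_iff_of_nonneg fun t _ ↦ ha t).1 h t (Finset.mem_univ t), zero_mul]
    · rw [div_self h, mul_one]
  have hcb : ∀ t, δ / δ * b t = b t := by
    intro t
    rcases eq_or_ne δ 0 with h | h
    · rw [(Finset.sum_eq_zero_iff_of_nonneg fun t _ ↦ hb t).1 (hδ.trans h) t (Finset.mem_univ t),
        mul_zero]
    · rw [div_self h, one_mul]
  set J₀ : T → T → ℝ := fun t' t ↦ (if t' = t then min (Q t) (τ t) else 0) + a t' * b t / δ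
  have hJ₀ : ∀ t' t, 0 ≤ J₀ t' t := by
    intro t' t
    have h1 : 0 ≤ a t' * b t / δ := div_nonneg (mul_nonneg (ha _) (hb _)) hδ0
    have h2 : 0 ≤ min (Q t) (τ t) := le_min (hQ t) (hτ t)
    simp only [J₀]
    split_ifs <;> linarith
  have hrow : ∀ t', ∑ t, J₀ t' t = Q t' := by
    intro t'
    simp only [J₀, Finset.sum_add_distrib, Finset.sum_ite_eq, Finset.mem_univ, if_true]
    rw [← Finset.sum_div, ← Finset.mul_sum, hδ, mul_div_assoc, hca]
    simp [a]
  have hcol : ∀ t, ∑ t', J₀ t' t = τ t := by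
    intro t
    simp only [J₀, Finset.sum_add_distrib, Finset.sum_ite_eq', Finset.mem_univ, if_true]
    rw [← Finset.sum_div, ← Finset.sum_mul, mul_div_right_comm, hcb]
    simp [b]
  -- Where `Q` vanishes, so do the weights `P`, and division by zero does no harm.
  have hPdiv : ∀ s, P s / Q (f s) * Q (f s) = P s := by
    intro s
    rcases eq_or_ne (Q (f s)) 0 with h | h
    · have := hPQ s
      rw [h] at this ⊢
      rw [mul_zero, le_antisymm this (hP s)]
    · rw [div_mul_cancel₀ _ h]
  have hglue : ∀ g : T → ℝ, (∀ t, 0 ≤ g t) → (∀ t, g t ≤ Q t) →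
      ∑ s, P s / Q (f s) * g (f s) = ∑ t, g t := by
    intro g hg hgQ
    have h1 := hsumQ fun t ↦ g t / Q t
    rw [show ∑ s, P s / Q (f s) * g (f s) = ∑ s, P s * (g (f s) / Q (f s)) from
      Finset.sum_congr rfl fun s _ ↦ by ring, h1]
    refine Finset.sum_congr rfl fun t _ ↦ ?_
    rcases eq_or_ne (Q t) 0 with h | h
    · have := hgQ t
      rw [h] at this ⊢
      rw [zero_mul, le_antisymm this (hg t)]
    · rw [mul_div_cancel₀ _ h]
  refine ⟨fun s t ↦ P s / Q (f s) * J₀ (f s) t,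
    fun s t ↦ mul_nonneg (div_nonneg (hP s) (hQ _)) (hJ₀ _ _), fun s ↦ ?_, fun t ↦ ?_, ?_⟩
  · rw [← Finset.mul_sum, hrow, hPdiv]
  · rw [hglue (fun t' ↦ J₀ t' t) (fun t' ↦ hJ₀ t' t) (fun t' ↦ ?_), hcol]
    rw [← hrow t']
    exact Finset.single_le_sum (f := fun t ↦ J₀ t' t) (fun t _ ↦ hJ₀ t' t) (Finset.mem_univ t)
  · have h1 : ∀ s, ∑ t, (if f s ≠ t then P s / Q (f s) * J₀ (f s) t else 0) ≤
        P s / Q (f s) * a (f s) := by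
      intro s
      calc _ ≤ ∑ t, P s / Q (f s) * (a (f s) * b t / δ) := by
            refine Finset.sum_le_sum fun t _ ↦ ?_
            have h2 : 0 ≤ P s / Q (f s) * (a (f s) * b t / δ) :=
              mul_nonneg (div_nonneg (hP s) (hQ _)) (div_nonneg (mul_nonneg (ha _) (hb _)) hδ0)
            split_ifs with h
            · simp [J₀, h]
            · exact h2
        _ = P s / Q (f s) * a (f s) := by
            rw [← Finset.mul_sum, ← Finset.sum_div, ← Finset.mul_sum, hδ, mul_div_assoc, hca]
    refine (Finset.sum_le_sum fun s _ ↦ h1 s).trans ?_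
    rw [hglue a ha fun t ↦ sub_le_self _ (le_min (hQ t) (hτ t))]
    refine Finset.sum_le_sum fun t _ ↦ ?_
    simp only [a]
    rcases le_total (Q t) (τ t) with h | h
    · rw [min_eq_left h, sub_self]
      exact abs_nonneg _
    · rw [min_eq_right h]
      exact le_abs_self _

/-! ### Connectivity -/

section connectivity

variable {L R : Type*} [Fintype L] [Fintype R] [DecidableEq L] [DecidableEq R] {q : ℝ}

/-- Summing a product function against the weights of a `0`-`1` matrix. -/
lemma sum_matWeight_mul_prod (q : ℝ) (g : L → R → Bool → ℝ) :
    ∑ M : L → R → Bool, matWeight q M * ∏ v, ∏ u, g v u (M v u) =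
      ∏ v, ∏ u, (q * g v u true + (1 - q) * g v u false) := by
  have h1 : ∀ v, ∑ m : R → Bool, rowWeight q m * ∏ u, g v u (m u) =
      ∏ u, (q * g v u true + (1 - q) * g v u false) := by
    intro v
    have h2 := sum_prod_eq_prod_sum (fun (u : R) (b : Bool) ↦ (if b then q else 1 - q) * g v u b)
    simp only [Fintype.sum_bool, if_true, Bool.false_eq_true, if_false] at h2
    rw [← h2]
    refine Finset.sum_congr rfl fun m _ ↦ ?_
    rw [rowWeight, Finset.prod_mul_distrib]
  simp only [← h1]
  rw [← sum_prod_eq_prod_sum fun v m ↦ rowWeight q m * ∏ u, g v u (m u)]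
  refine Finset.sum_congr rfl fun M _ ↦ ?_
  rw [Finset.prod_mul_distrib, matWeight]

/-- A vertex of `R` is isolated with probability `(1 - q) ^ |L|`. -/
lemma sum_matWeight_isolated (q : ℝ) (u : R) :
    ∑ M : L → R → Bool, matWeight q M * (if ∀ v, M v u = false then 1 else 0) =
      (1 - q) ^ Fintype.card L := by
  have h1 := sum_matWeight_mul_prod (L := L) q
    (fun _ u' b ↦ if u' = u → b = false then 1 else 0)
  have h2 : ∀ v : L, ∏ u' : R, (q * (if u' = u → true = false then 1 else 0) +
      (1 - q) * (if u' = u → false = false then 1 else 0)) = 1 - q := by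
    intro v
    rw [Finset.prod_eq_single u]
    · simp
    · intro u' _ hu'
      simp [hu']
    · simp
  rw [Finset.prod_congr rfl fun v _ ↦ h2 v, Finset.prod_const, Finset.card_univ] at h1
  rw [← h1]
  refine Finset.sum_congr rfl fun M _ ↦ ?_
  congr 1
  simp only [Finset.prod_ite_zero, Finset.prod_const_one, Finset.mem_univ, true_imp_iff]
  congr 1
  simp

/-- Two vertices of `L` have no common neighbour with probability `(1 - q²) ^ |R|`. -/
lemma sum_matWeight_no_common (q : ℝ) {v w : L} (hvw : v ≠ w) :
    ∑ M : L → R → Bool, matWeight q M * (if ∀ u, ¬ (M v u = true ∧ M w u = true) then 1 else 0) =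
      (1 - q ^ 2) ^ Fintype.card R := by
  -- Inclusion-exclusion at each vertex of `R`: the indicator is the product of `1 - Mᵥ M_w`.
  have h0 : ∀ M : L → R → Bool, (if ∀ u, ¬ (M v u = true ∧ M w u = true) then (1 : ℝ) else 0) =
      ∑ A ∈ (Finset.univ : Finset R).powerset, (-1) ^ A.card *
        ∏ v', ∏ u, if u ∈ A → (v' = v ∨ v' = w) → M v' u = true then 1 else 0 := by
    intro M
    have h1 : (if ∀ u, ¬ (M v u = true ∧ M w u = true) then (1 : ℝ) else 0) =
        ∏ u, (1 + -(if M v u = true ∧ M w u = true then 1 else 0)) := by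
      have h2 : ∀ u, (1 : ℝ) + -(if M v u = true ∧ M w u = true then 1 else 0) =
          if ¬ (M v u = true ∧ M w u = true) then 1 else 0 := by
        intro u
        split_ifs <;> simp_all
      simp only [h2, Finset.prod_ite_zero, Finset.prod_const_one, Finset.mem_univ, true_imp_iff]
    rw [h1, Finset.prod_one_add]
    refine Finset.sum_congr rfl fun A _ ↦ ?_
    rw [Finset.prod_neg, Finset.prod_ite_zero, Finset.prod_const_one]
    simp only [Finset.prod_ite_zero, Finset.prod_const_one, Finset.mem_univ, true_imp_iff]
    congr 2
    refine propext ⟨fun h v' u hu hv' ↦ ?_, fun h u hu ↦ ?_⟩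
    · rcases hv' with rfl | rfl
      · exact (h u hu).1
      · exact (h u hu).2
    · exact ⟨h v u hu (Or.inl rfl), h w u hu (Or.inr rfl)⟩
  simp only [h0, Finset.mul_sum]
  rw [Finset.sum_comm]
  have h3 : ∀ A : Finset R, ∑ M : L → R → Bool, matWeight q M * ((-1) ^ A.card *
        ∏ v', ∏ u, if u ∈ A → (v' = v ∨ v' = w) → M v' u = true then 1 else 0) =
      (-q ^ 2) ^ A.card := by
    intro A
    have h4 := sum_matWeight_mul_prod (L := L) q
      (fun v' u b ↦ if u ∈ A → (v' = v ∨ v' = w) → b = true then 1 else 0)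
    have h5 : ∀ v', ∏ u : R, (q * (if u ∈ A → (v' = v ∨ v' = w) → true = true then 1 else 0) +
        (1 - q) * (if u ∈ A → (v' = v ∨ v' = w) → false = true then 1 else 0)) =
        if v' = v ∨ v' = w then q ^ A.card else 1 := by
      intro v'
      have h6 : ∀ u, (q * (if u ∈ A → (v' = v ∨ v' = w) → true = true then 1 else 0) +
        (1 - q) * (if u ∈ A → (v' = v ∨ v' = w) → false = true then 1 else 0)) =
          if u ∈ A then (if v' = v ∨ v' = w then q else 1) else 1 := by
        intro u
        by_cases h1 : u ∈ A <;> by_cases h2 : v' = v ∨ v' = w <;> simp [h1, h2]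
      rw [Finset.prod_congr rfl fun u _ ↦ h6 u, Finset.prod_ite_mem, Finset.univ_inter,
        Finset.prod_const]
      split_ifs <;> simp
    rw [Finset.prod_congr rfl fun v' _ ↦ h5 v'] at h4
    have h7 : ∏ v', (if v' = v ∨ v' = w then q ^ A.card else 1) = q ^ A.card * q ^ A.card := by
      rw [← Finset.prod_pair hvw (f := fun _ ↦ q ^ A.card), ← Finset.prod_filter]
      congr 1
      ext v'
      simp
    rw [h7] at h4
    simp only [mul_left_comm (matWeight q _)]
    rw [← Finset.mul_sum, h4, neg_pow (q ^ 2)]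
    ring
  simp only [h3]
  have h8 := Finset.prod_one_add (f := fun _ : R ↦ -q ^ 2) (s := Finset.univ)
  simp only [Finset.prod_const, Finset.card_univ] at h8
  rw [← h8, ← sub_eq_add_neg]

/-- The random bipartite graph is connected up to an exponentially small probability. -/
lemma sum_matWeight_disconnected_le (hq0 : 0 ≤ q) (hq1 : q ≤ 1) :
    ∑ M : L → R → Bool, matWeight q M *
        (if 1 < Nat.card (matrixGraph M).ConnectedComponent then 1 else 0) ≤
      Fintype.card L ^ 2 * (1 - q ^ 2) ^ Fintype.card R +
        Fintype.card R * (1 - q) ^ Fintype.card L := by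
  have hind : ∀ M : L → R → Bool,
      (if 1 < Nat.card (matrixGraph M).ConnectedComponent then (1 : ℝ) else 0) ≤
      (∑ x : L × L, if x.1 ≠ x.2 then
        (if ∀ u, ¬ (M x.1 u = true ∧ M x.2 u = true) then 1 else 0) else 0) +
      ∑ u : R, if ∀ v, M v u = false then 1 else 0 := by
    intro M
    have hnn1 : ∀ x : L × L, (0 : ℝ) ≤ if x.1 ≠ x.2 then
        (if ∀ u, ¬ (M x.1 u = true ∧ M x.2 u = true) then 1 else 0) else 0 := fun x ↦ by
      split_ifs <;> norm_num
    have hnn2 : ∀ u : R, (0 : ℝ) ≤ if ∀ v, M v u = false then 1 else 0 := fun u ↦ by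
      split_ifs <;> norm_num
    have hs1 := Finset.sum_nonneg fun x (_ : x ∈ Finset.univ) ↦ hnn1 x
    have hs2 := Finset.sum_nonneg fun u (_ : u ∈ Finset.univ) ↦ hnn2 u
    split_ifs with h
    · by_contra hcon
      rw [not_le] at hcon
      refine h.not_ge (card_connectedComponent_matrixGraph_le_one ?_ ?_)
      · intro v w hvw
        by_contra! hno
        have h1 := Finset.single_le_sum (fun x _ ↦ hnn1 x) (Finset.mem_univ (v, w))
        rw [if_pos hvw, if_pos (by simpa using hno)] at h1
        linarith
      · intro u
        by_contra! hno
        have h1 := Finset.single_le_sum (fun u _ ↦ hnn2 u) (Finset.mem_univ u)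
        rw [if_pos (by simpa using hno)] at h1
        linarith
    · linarith
  have hq2 : (0 : ℝ) ≤ (1 - q ^ 2) ^ Fintype.card R := pow_nonneg (by nlinarith) _
  calc _ ≤ ∑ M : L → R → Bool, matWeight q M * ((∑ x : L × L, if x.1 ≠ x.2 then
        (if ∀ u, ¬ (M x.1 u = true ∧ M x.2 u = true) then 1 else 0) else 0) +
      ∑ u : R, if ∀ v, M v u = false then 1 else 0) :=
        Finset.sum_le_sum fun M _ ↦ mul_le_mul_of_nonneg_left (hind M)
          (matWeight_nonneg hq0 hq1 M)
    _ = (∑ x : L × L, ∑ M : L → R → Bool, matWeight q M * if x.1 ≠ x.2 then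
        (if ∀ u, ¬ (M x.1 u = true ∧ M x.2 u = true) then 1 else 0) else 0) +
        ∑ u : R, ∑ M : L → R → Bool, matWeight q M * if ∀ v, M v u = false then 1 else 0 := by
        simp only [mul_add, Finset.mul_sum, Finset.sum_add_distrib]
        congr 1 <;> exact Finset.sum_comm
    _ ≤ _ := by
        refine add_le_add ?_ ?_
        · refine (Finset.sum_le_card_nsmul _ _ ((1 - q ^ 2) ^ Fintype.card R)
            fun x _ ↦ ?_).trans (le_of_eq ?_)
          · by_cases hx : x.1 ≠ x.2
            · simp only [if_pos hx]
              exact (sum_matWeight_no_common q hx).le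
            · simp only [if_neg hx]
              simpa using hq2
          · simp [sq]
        · simp only [sum_matWeight_isolated]
          simp

end connectivity

/-! ### Laws on finite spaces -/

/-- The measure on a finite type given by weights. -/
noncomputable def weightMeasure {S : Type*} [Fintype S] [MeasurableSpace S] (J : S → ℝ) :
    Measure S :=
  ∑ s, ENNReal.ofReal (J s) • Measure.dirac s

section weightMeasure

variable {S : Type*} [Fintype S] [MeasurableSpace S] [DiscreteMeasurableSpace S] {J : S → ℝ}

open Classical in
lemma weightMeasure_apply (A : Set S) :
    weightMeasure J A = ∑ s, if s ∈ A then ENNReal.ofReal (J s) else 0 := by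
  simp [weightMeasure, Measure.finsetSum_apply, Set.indicator_apply]

open Classical in
lemma weightMeasure_real_apply (hJ : ∀ s, 0 ≤ J s) (A : Set S) :
    (weightMeasure J).real A = ∑ s, if s ∈ A then J s else 0 := by
  rw [measureReal_def, weightMeasure_apply, ENNReal.toReal_sum]
  · refine Finset.sum_congr rfl fun s _ ↦ ?_
    split_ifs
    · rw [ENNReal.toReal_ofReal (hJ s)]
    · simp
  · intro s _
    split_ifs <;> simp

lemma isProbabilityMeasure_weightMeasure (hJ : ∀ s, 0 ≤ J s) (h1 : ∑ s, J s = 1) :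
    IsProbabilityMeasure (weightMeasure J) := by
  refine ⟨?_⟩
  rw [weightMeasure_apply]
  simp only [Set.mem_univ, if_true]
  rw [← ENNReal.ofReal_sum_of_nonneg fun s _ ↦ hJ s, h1, ENNReal.ofReal_one]

end weightMeasure

/-- The space on which a `0`-`1` matrix and the degrees mod `p` of the vertices of its first side
are coupled. -/
def CouplingSpace (p n r : ℕ) : Type := (Fin n → Fin r → Bool) × (Fin n → ZMod p)

instance (p n r : ℕ) : MeasurableSpace (CouplingSpace p n r) := ⊤

instance (p n r : ℕ) : DiscreteMeasurableSpace (CouplingSpace p n r) := ⟨fun _ ↦ trivial⟩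

noncomputable instance (p n r : ℕ) [NeZero p] : Fintype (CouplingSpace p n r) :=
  inferInstanceAs (Fintype ((Fin n → Fin r → Bool) × (Fin n → ZMod p)))

section laws

variable {p : ℕ} [Fact p.Prime]

/-- The random set of edges has the Bernoulli law. -/
lemma map_weightMeasure_edges {n r : ℕ} {q : unitInterval} {J : CouplingSpace p n r → ℝ}
    (hJ : ∀ ω, 0 ≤ J ω) (hJ1 : ∀ M, ∑ d, J (M, d) = matWeight (q : ℝ) M)
    [IsFiniteMeasure (weightMeasure J)] :
    (weightMeasure J).map (fun ω ↦ ({e | ω.1 e.1 e.2 = true} : Set (Fin n × Fin r))) =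
      setBernoulli Set.univ q := by
  classical
  refine Measure.ext_of_measureReal_singleton fun E ↦ ?_
  rw [map_measureReal_apply (Measurable.of_discrete) (measurableSet_singleton E),
    weightMeasure_real_apply hJ, setBernoulli_real_singleton q (Set.subset_univ E) Set.finite_univ]
  set M₀ : Fin n → Fin r → Bool := fun v u ↦ decide ((v, u) ∈ E)
  have h1 : ∀ M : Fin n → Fin r → Bool, ({e | M e.1 e.2 = true} : Set (Fin n × Fin r)) = E ↔
      M = M₀ := by
    intro M
    constructor
    · rintro rfl
      funext v u
      simp [M₀]
    · rintro rfl
      ext ⟨v, u⟩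
      simp [M₀]
  calc _ = ∑ M : Fin n → Fin r → Bool, ∑ d : Fin n → ZMod p, if M = M₀ then J (M, d) else 0 := by
        rw [← Fintype.sum_prod_type']
        refine Finset.sum_congr rfl fun ω _ ↦ ?_
        simp only [Set.mem_preimage, Set.mem_singleton_iff]
        exact if_congr (h1 ω.1) rfl rfl
    _ = matWeight (q : ℝ) M₀ := by
        rw [Finset.sum_eq_single M₀]
        · simp [hJ1]
        · intro M _ hM
          simp [hM]
        · simp
    _ = _ := by
        have h2 : matWeight (q : ℝ) M₀ =
            ∏ e : Fin n × Fin r, if e ∈ E then (q : ℝ) else 1 - q := by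
          rw [Fintype.prod_prod_type]
          simp [matWeight, rowWeight, M₀]
        rw [h2, Finset.prod_ite, Finset.prod_const, Finset.prod_const,
          Set.ncard_eq_toFinset_card', Set.ncard_eq_toFinset_card']
        congr 2
        · congr 1
          ext e
          simp
        · congr 1
          ext e
          simp

lemma map_weightMeasure_matrixGraph {n : ℕ} {α : ℝ} {q : unitInterval}
    {J : CouplingSpace p n ⌊α * n⌋₊ → ℝ} (hJ : ∀ ω, 0 ≤ J ω)
    (hJ1 : ∀ M, ∑ d, J (M, d) = matWeight (q : ℝ) M) [IsFiniteMeasure (weightMeasure J)] :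
    (weightMeasure J).map (fun ω ↦ matrixGraph ω.1) = randomBipartiteLaw n α q := by
  rw [randomBipartiteLaw, ← map_weightMeasure_edges hJ hJ1,
    Measure.map_map Measurable.of_discrete Measurable.of_discrete]
  rfl

/-- The number of zeros of a uniform vector over `ZMod p` has the binomial law. -/
lemma map_weightMeasure_zeroCount {n r : ℕ} {J : CouplingSpace p n r → ℝ}
    (hJ : ∀ ω, 0 ≤ J ω) (hJ2 : ∀ d, ∑ M, J (M, d) = ((p : ℝ) ^ n)⁻¹)
    [IsFiniteMeasure (weightMeasure J)] :
    (weightMeasure J).map (fun ω ↦ zeroCount ω.2) = binomial n (oneDivNat p) := by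
  classical
  have hp0 : (0 : ℝ) < p := by exact_mod_cast (Fact.out : p.Prime).pos
  have hp1 : 1 ≤ p := (Fact.out : p.Prime).one_le
  have hset : (weightMeasure J).map (fun ω ↦ ({v | ω.2 v = 0} : Set (Fin n))) =
      setBernoulli Set.univ (oneDivNat p) := by
    refine Measure.ext_of_measureReal_singleton fun E ↦ ?_
    rw [map_measureReal_apply (Measurable.of_discrete) (measurableSet_singleton E),
      weightMeasure_real_apply hJ,
      setBernoulli_real_singleton _ (Set.subset_univ E) Set.finite_univ]
    have h1 : ∀ d : Fin n → ZMod p, ({v | d v = 0} : Set (Fin n)) = E ↔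
        d ∈ Fintype.piFinset fun v ↦ if v ∈ E then {0} else Finset.univ.erase 0 := by
      intro d
      simp only [Set.ext_iff, Set.mem_ofPred_eq, Fintype.mem_piFinset]
      refine forall_congr' fun v ↦ ?_
      by_cases hv : v ∈ E <;> simp [hv]
    calc _ = ∑ d : Fin n → ZMod p, ∑ M : Fin n → Fin r → Bool,
          if ({v | d v = 0} : Set (Fin n)) = E then J (M, d) else 0 := by
          rw [← Fintype.sum_prod_type_right']
          rfl
      _ = ∑ d : Fin n → ZMod p, if d ∈ Fintype.piFinset
            fun v ↦ (if v ∈ E then {0} else Finset.univ.erase 0) then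
            ((p : ℝ) ^ n)⁻¹ else 0 := by
          refine Finset.sum_congr rfl fun d _ ↦ ?_
          rw [← if_congr (h1 d) rfl rfl, ← hJ2 d]
          split_ifs <;> simp
      _ = ∏ v : Fin n, if v ∈ E then (1 / p : ℝ) else 1 - 1 / p := by
          have h2 : ∀ v : Fin n, (if v ∈ E then (1 / p : ℝ) else 1 - 1 / p) =
              ((if v ∈ E then ({0} : Finset (ZMod p)) else Finset.univ.erase 0).card : ℝ) *
                (p : ℝ)⁻¹ := by
            intro v
            split_ifs
            · simp
            · rw [Finset.card_erase_of_mem (Finset.mem_univ _), Finset.card_univ, ZMod.card,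
                Nat.cast_sub hp1]
              field_simp
              simp
          rw [Finset.sum_ite_mem, Finset.univ_inter, Finset.sum_const, nsmul_eq_mul,
            Fintype.card_piFinset, Finset.prod_congr rfl fun v _ ↦ h2 v, Finset.prod_mul_distrib,
            Finset.prod_const, Finset.card_univ, Fintype.card_fin, Nat.cast_prod, inv_pow]
      _ = _ := by
          rw [Finset.prod_ite, Finset.prod_const, Finset.prod_const,
            Set.ncard_eq_toFinset_card', Set.ncard_eq_toFinset_card']
          congr 2
          · congr 1
            ext e
            simp
          · congr 1
            ext e
            simp
  have hcount : (fun ω : CouplingSpace p n r ↦ zeroCount ω.2) =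
      Set.ncard ∘ fun ω ↦ ({v | ω.2 v = 0} : Set (Fin n)) := by
    funext ω
    rw [Function.comp_apply, zeroCount, Set.ncard_eq_toFinset_card']
    congr 1
    ext v
    simp
  rw [hcount, ← Measure.map_map Measurable.of_discrete Measurable.of_discrete, hset]
  refine Measure.ext_of_measureReal_singleton fun k ↦ ?_
  rw [map_ncard_setBernoulli_real_singleton Set.finite_univ, binomial_real_singleton]
  simp

end laws

/-! ### The tail of the distance -/

lemma exists_sq_mul_pow_floor_le {β α : ℝ} (hβ0 : 0 < β) (hβ1 : β < 1) (hα : 0 < α) :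
    ∃ c > (0 : ℝ), ∃ K > (0 : ℝ), ∀ n : ℕ,
      (n : ℝ) ^ 2 * β ^ ⌊α * n⌋₊ ≤ K * Real.exp (-(c * n)) := by
  set γ := β ^ (α / 2)
  have hγ0 : 0 < γ := Real.rpow_pos_of_pos hβ0 _
  have hγ1 : γ < 1 := Real.rpow_lt_one hβ0.le hβ1 (by positivity)
  have hlim := tendsto_pow_const_mul_const_pow_of_abs_lt_one 2
    (show |γ| < 1 by rwa [abs_of_pos hγ0])
  obtain ⟨K, hK⟩ := hlim.bddAbove_range
  have hK' : ∀ n : ℕ, (n : ℝ) ^ 2 * γ ^ n ≤ max K 1 := fun n ↦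
    (hK ⟨n, rfl⟩).trans (le_max_left _ _)
  have hK0 : 0 < max K 1 := lt_max_of_lt_right one_pos
  refine ⟨-Real.log γ, neg_pos.2 (Real.log_neg hγ0 hγ1), max K 1 * β⁻¹, by positivity,
    fun n ↦ ?_⟩
  have h1 : Real.exp (-(-Real.log γ * n)) = γ ^ n := by
    rw [neg_mul, neg_neg, mul_comm, Real.exp_nat_mul, Real.exp_log hγ0]
  have h2 : β ^ ⌊α * n⌋₊ ≤ β⁻¹ * (γ ^ n * γ ^ n) := by
    have h3 : γ ^ n * γ ^ n = β ^ (α * n) := by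
      rw [← pow_add, ← Real.rpow_natCast, ← Real.rpow_mul hβ0.le]
      congr 1
      push_cast
      ring
    have h4 : α * n ≤ ((⌊α * n⌋₊ + 1 : ℕ) : ℝ) := by
      push_cast
      exact (Nat.lt_floor_add_one _).le
    have h5 : β ^ (⌊α * n⌋₊ + 1) ≤ β ^ (α * n) := by
      rw [← Real.rpow_natCast]
      exact Real.rpow_le_rpow_of_exponent_ge hβ0 hβ1.le h4
    rw [h3, ← div_eq_inv_mul, le_div_iff₀ hβ0, ← pow_succ]
    exact h5
  rw [h1]
  calc (n : ℝ) ^ 2 * β ^ ⌊α * n⌋₊ ≤ (n : ℝ) ^ 2 * (β⁻¹ * (γ ^ n * γ ^ n)) :=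
        mul_le_mul_of_nonneg_left h2 (by positivity)
    _ = ((n : ℝ) ^ 2 * γ ^ n) * (β⁻¹ * γ ^ n) := by ring
    _ ≤ max K 1 * (β⁻¹ * γ ^ n) := mul_le_mul_of_nonneg_right (hK' n) (by positivity)
    _ = _ := by ring

section tail

variable {p : ℕ} [Fact p.Prime]

lemma abs_pRank_sub_le {n : ℕ} {α : ℝ} (hα0 : 0 < α) (hα1 : α < 1)
    (M : Fin n → Fin ⌊α * n⌋₊ → Bool) (d : Fin n → ZMod p) :
    |(pRank p (SandpileGroup (matrixGraph M)) : ℝ) - max ((zeroCount d : ℝ) - α * n) 0| ≤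
      2 * n := by
  have h1 := pRank_sandpileGroup_le p (matrixGraph M)
  have h2 := finrank_lapKer_matrixGraph_le p M
  rw [Fintype.card_fin, Fintype.card_fin] at h2
  have h3 : zeroCount d ≤ n := (Finset.card_le_univ _).trans (Fintype.card_fin n).le
  have h4 : ((⌊α * n⌋₊ : ℕ) : ℝ) ≤ α * n := Nat.floor_le (by positivity)
  have h5 : ((pRank p (SandpileGroup (matrixGraph M)) : ℕ) : ℝ) ≤ n + ⌊α * n⌋₊ := by
    exact_mod_cast h1.trans h2
  have h6 : (zeroCount d : ℝ) ≤ n := by exact_mod_cast h3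
  have h7 : (0 : ℝ) ≤ n := by positivity
  have h8 : α * n ≤ n := by nlinarith
  have h9 : 0 ≤ α * n := by positivity
  rw [abs_le]
  constructor
  · have : max ((zeroCount d : ℝ) - α * n) 0 ≤ n := max_le (by linarith) h7
    have h10 : (0 : ℝ) ≤ (pRank p (SandpileGroup (matrixGraph M)) : ℝ) := by positivity
    linarith
  · have := le_max_right ((zeroCount d : ℝ) - α * n) 0
    linarith

/-- For connected graphs, the `p`-rank is close to the lower bound if the corank of the laplacian
mod `p` is. -/
lemma abs_pRank_sub_le_of_connected {n : ℕ} {α : ℝ} (hα0 : 0 < α)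
    (M : Fin n → Fin ⌊α * n⌋₊ → Bool)
    (hM : Nat.card (matrixGraph M).ConnectedComponent ≤ 1) {d : Fin n → ZMod p}
    (hd : (fun v ↦ rowDeg p (M v)) = d) :
    |(pRank p (SandpileGroup (matrixGraph M)) : ℝ) - max ((zeroCount d : ℝ) - α * n) 0| ≤
      (Module.finrank (ZMod p) ((matrixGraph M).lapKer p) -
        (zeroCount (fun v ↦ rowDeg p (M v)) - Fintype.card (Fin ⌊α * n⌋₊)) : ℕ) + 1 := by
  subst hd
  have h1 := pRank_sandpileGroup_le p (matrixGraph M)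
  have h2 := finrank_lapKer_le p (matrixGraph M)
  have h3 : zeroCount (fun v ↦ rowDeg p (M v)) ≤ _ := card_rowDeg_eq_zero_le p M
  set κ := Module.finrank (ZMod p) ((matrixGraph M).lapKer p)
  set Z := zeroCount fun v ↦ rowDeg p (M v)
  set X := pRank p (SandpileGroup (matrixGraph M))
  rw [Fintype.card_fin] at h3 ⊢
  set r := ⌊α * n⌋₊
  have h4 : (r : ℝ) ≤ α * n := Nat.floor_le (by positivity)
  have h5 : α * n < r + 1 := Nat.lt_floor_add_one _
  have h6 : (X : ℝ) ≤ κ := by exact_mod_cast h1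
  have h7 : (κ : ℝ) ≤ X + 1 := by exact_mod_cast h2.trans (Nat.add_le_add_left hM _)
  have h8 : (((κ - (Z - r) : ℕ) : ℕ) : ℝ) = κ - ((Z - r : ℕ) : ℝ) := Nat.cast_sub (by omega)
  have h9 : max ((Z : ℝ) - α * n) 0 ≤ ((Z - r : ℕ) : ℝ) := by
    refine max_le ?_ (by positivity)
    have : (Z : ℝ) ≤ ((Z - r : ℕ) : ℝ) + r := by exact_mod_cast (by omega : Z ≤ Z - r + r)
    linarith
  have h10 : ((Z - r : ℕ) : ℝ) - 1 ≤ max ((Z : ℝ) - α * n) 0 := by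
    rcases le_total r Z with h | h
    · refine le_trans ?_ (le_max_left _ _)
      rw [Nat.cast_sub h]
      linarith
    · refine le_trans ?_ (le_max_right _ _)
      rw [Nat.sub_eq_zero_of_le h]
      norm_num
  have h11 : ((Z - r : ℕ) : ℝ) ≤ κ := by exact_mod_cast (by omega : Z - r ≤ κ)
  rw [h8, abs_le]
  constructor <;> linarith

/-- The coupling of the random matrix with a uniform vector of degrees. -/
lemma exists_couplingSpace_weights (p : ℕ) [Fact p.Prime] {q ρ : ℝ} (hq0 : 0 ≤ q) (hq1 : q ≤ 1)
    (hρ0 : 0 ≤ ρ) (hρ : ∀ t : ZMod p, t ≠ 0 → ‖bernoulliChar p q t‖ ≤ ρ) (n r : ℕ) :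
    ∃ J : CouplingSpace p n r → ℝ, (∀ ω, 0 ≤ J ω) ∧
      (∀ M, ∑ d, J (M, d) = matWeight q M) ∧ (∀ d, ∑ M, J (M, d) = ((p : ℝ) ^ n)⁻¹) ∧
      ∑ ω : CouplingSpace p n r, (if (fun v ↦ rowDeg p (ω.1 v)) ≠ ω.2 then J ω else 0) ≤
        Real.exp (n * (p * ρ ^ r)) - 1 := by
  have hp0 : (0 : ℝ) < p := by exact_mod_cast (Fact.out : p.Prime).pos
  obtain ⟨J, h0, h1, h2, h3⟩ := exists_coupling
    (P := fun M : Fin n → Fin r → Bool ↦ matWeight q M)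
    (τ := fun _ : Fin n → ZMod p ↦ ((p : ℝ) ^ n)⁻¹) (fun M v ↦ rowDeg p (M v))
    (matWeight_nonneg hq0 hq1) (fun _ ↦ by positivity) (sum_matWeight p q) (by
      rw [Finset.sum_const, Finset.card_univ, Fintype.card_fun, ZMod.card, Fintype.card_fin,
        nsmul_eq_mul]
      push_cast
      field_simp)
  refine ⟨fun ω ↦ J ω.1 ω.2, fun ω ↦ h0 _ _, h1, h2, ?_⟩
  have h4 := sum_abs_prod_rowProb_sub_le (L := Fin n) (R := Fin r) hρ0 hρ
  simp only [sum_matWeight_rowDeg_eq] at h3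
  rw [Fintype.card_fin, Fintype.card_fin] at h4
  refine le_trans (le_of_eq ?_) (h3.trans h4)
  rw [← Fintype.sum_prod_type']
  rfl

lemma sum_couplingSpace {n r : ℕ} (f : CouplingSpace p n r → ℝ) :
    ∑ ω, f ω = ∑ M : Fin n → Fin r → Bool, ∑ d : Fin n → ZMod p, f (M, d) :=
  Fintype.sum_prod_type _

/-- The probability of a large distance is at most the probability that the degrees differ from
the uniform vector, plus the probability that the graph is disconnected, plus a term coming from
the exponential moment of the corank. -/
lemma sum_abs_pRank_sub_ge_le {n : ℕ} {α q B : ℝ} (hα0 : 0 < α)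
    {J : CouplingSpace p n ⌊α * n⌋₊ → ℝ} (hJ : ∀ ω, 0 ≤ J ω)
    (hJ1 : ∀ M, ∑ d, J (M, d) = matWeight q M)
    (hB : ∑ M : Fin n → Fin ⌊α * n⌋₊ → Bool, matWeight q M *
        (p : ℝ) ^ (Module.finrank (ZMod p) ((matrixGraph M).lapKer p) -
          (zeroCount (fun v ↦ rowDeg p (M v)) - Fintype.card (Fin ⌊α * n⌋₊))) ≤ B) (m : ℝ) :
    ∑ ω : CouplingSpace p n ⌊α * n⌋₊, (if m ≤ |(pRank p (SandpileGroup (matrixGraph ω.1)) : ℝ) -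
        max ((zeroCount ω.2 : ℝ) - α * n) 0| then J ω else 0) ≤
      ∑ ω : CouplingSpace p n ⌊α * n⌋₊, (if (fun v ↦ rowDeg p (ω.1 v)) ≠ ω.2 then J ω else 0) +
      ∑ M : Fin n → Fin ⌊α * n⌋₊ → Bool, matWeight q M *
        (if 1 < Nat.card (matrixGraph M).ConnectedComponent then 1 else 0) +
      p * Real.exp (-(Real.log p * m)) * B := by
  have hp0 : (0 : ℝ) < p := by exact_mod_cast (Fact.out : p.Prime).pos
  have hp1 : (1 : ℝ) < p := by exact_mod_cast (Fact.out : p.Prime).one_lt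
  set t : (Fin n → Fin ⌊α * n⌋₊ → Bool) → ℕ := fun M ↦
    Module.finrank (ZMod p) ((matrixGraph M).lapKer p) -
      (zeroCount (fun v ↦ rowDeg p (M v)) - Fintype.card (Fin ⌊α * n⌋₊)) with ht
  have hmarg : ∀ g : (Fin n → Fin ⌊α * n⌋₊ → Bool) → ℝ,
      ∑ M, matWeight q M * g M = ∑ ω : CouplingSpace p n ⌊α * n⌋₊, J ω * g ω.1 := by
    intro g
    rw [sum_couplingSpace]
    refine Finset.sum_congr rfl fun M _ ↦ ?_
    rw [← hJ1, Finset.sum_mul]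
  have hpt : ∀ ω : CouplingSpace p n ⌊α * n⌋₊,
      (if m ≤ |(pRank p (SandpileGroup (matrixGraph ω.1)) : ℝ) -
        max ((zeroCount ω.2 : ℝ) - α * n) 0| then J ω else 0) ≤
      (if (fun v ↦ rowDeg p (ω.1 v)) ≠ ω.2 then J ω else 0) +
      J ω * (if 1 < Nat.card (matrixGraph ω.1).ConnectedComponent then 1 else 0) +
      p * Real.exp (-(Real.log p * m)) * (J ω * (p : ℝ) ^ t ω.1) := by
    intro ω
    have hJω := hJ ω
    have hpos : 0 ≤ p * Real.exp (-(Real.log p * m)) * (J ω * (p : ℝ) ^ t ω.1) := by positivity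
    have h1 : 0 ≤ if (fun v ↦ rowDeg p (ω.1 v)) ≠ ω.2 then J ω else 0 := by
      split_ifs <;> first | exact hJω | exact le_rfl
    have h2 : 0 ≤ J ω *
        (if 1 < Nat.card (matrixGraph ω.1).ConnectedComponent then 1 else 0) :=
      mul_nonneg hJω (by split_ifs <;> norm_num)
    by_cases hm : m ≤ |(pRank p (SandpileGroup (matrixGraph ω.1)) : ℝ) -
        max ((zeroCount ω.2 : ℝ) - α * n) 0|
    · rw [if_pos hm]
      by_cases hd : (fun v ↦ rowDeg p (ω.1 v)) = ω.2
      · by_cases hc : 1 < Nat.card (matrixGraph ω.1).ConnectedComponent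
        · rw [if_pos hc] at h2 ⊢
          linarith
        · have h3 := hm.trans (abs_pRank_sub_le_of_connected hα0 ω.1 (not_lt.1 hc) hd)
          have h4 : (1 : ℝ) ≤ p * Real.exp (-(Real.log p * m)) * (p : ℝ) ^ t ω.1 := by
            have h5 : (p : ℝ) * Real.exp (-(Real.log p * m)) * (p : ℝ) ^ t ω.1 =
                Real.exp (Real.log p * (t ω.1 + 1 - m)) := by
              have h6 : Real.exp (Real.log p * (t ω.1 + 1 - m)) = Real.exp (Real.log p) *
                  Real.exp (-(Real.log p * m)) * Real.exp (t ω.1 * Real.log p) := by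
                rw [← Real.exp_add, ← Real.exp_add]
                congr 1
                ring
              rw [h6, Real.exp_nat_mul, Real.exp_log hp0]
            rw [h5]
            exact Real.one_le_exp (mul_nonneg (Real.log_pos hp1).le (by linarith))
          have h7 := mul_le_mul_of_nonneg_left h4 hJω
          linarith
      · rw [if_pos hd] at h1 ⊢
        linarith
    · rw [if_neg hm]
      positivity
  refine (Finset.sum_le_sum fun ω _ ↦ hpt ω).trans ?_
  rw [Finset.sum_add_distrib, Finset.sum_add_distrib, ← Finset.mul_sum]
  rw [← hmarg fun M ↦ if 1 < Nat.card (matrixGraph M).ConnectedComponent then 1 else 0,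
    ← hmarg fun M ↦ (p : ℝ) ^ t M]
  have := mul_le_mul_of_nonneg_left hB
    (by positivity : 0 ≤ p * Real.exp (-(Real.log p * m)))
  linarith

set_option maxHeartbeats 1000000 in
/-- An exponential bound for the tail of the distance, uniform in `n`. -/
lemma exists_tail_bound (p : ℕ) [Fact p.Prime] {α q : ℝ} (hα : 0 < α ∧ α < 1)
    (hq0 : 0 < q) (hq1 : q < 1) :
    ∃ c > (0 : ℝ), ∃ K > (0 : ℝ), ∀ n : ℕ, ∃ J : CouplingSpace p n ⌊α * n⌋₊ → ℝ,
      (∀ ω, 0 ≤ J ω) ∧ (∀ M, ∑ d, J (M, d) = matWeight q M) ∧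
      (∀ d, ∑ M, J (M, d) = ((p : ℝ) ^ n)⁻¹) ∧
      (0 < n → ∀ m : ℝ, 0 < m → ∑ ω : CouplingSpace p n ⌊α * n⌋₊,
        (if m ≤ |(pRank p (SandpileGroup (matrixGraph ω.1)) : ℝ) -
          max ((zeroCount ω.2 : ℝ) - α * n) 0| then J ω else 0) ≤ K * Real.exp (-(c * m))) := by
  have hp0 : (0 : ℝ) < p := by exact_mod_cast (Fact.out : p.Prime).pos
  have hp1 : (1 : ℝ) < p := by exact_mod_cast (Fact.out : p.Prime).one_lt
  obtain ⟨ρ, hρ0, hρ1, hρ⟩ := exists_norm_bernoulliChar_le p hq0 hq1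
  obtain ⟨N, hN⟩ := exists_parameters p hρ0 hρ1 hα.1
  -- `β` dominates the decay of both the bias of the degrees and the lack of common neighbours.
  set β := max ρ (1 - q ^ 2)
  have hq2 : q ^ 2 < q := by nlinarith
  have hβ0 : 0 < β := lt_max_of_lt_left hρ0
  have hβ1 : β < 1 := max_lt hρ1 (by nlinarith)
  obtain ⟨c₀, hc₀, K₀, hK₀, hdecay⟩ := exists_sq_mul_pow_floor_le hβ0 hβ1 hα.1
  set c := min (c₀ / 2) (Real.log p)
  have hc : 0 < c := lt_min (by positivity) (Real.log_pos hp1)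
  refine ⟨c, hc, (2 * p + 2) * K₀ + 16 * p ^ 7 + Real.exp (c * (2 * N)), by positivity,
    fun n ↦ ?_⟩
  obtain ⟨J, hJ, hJ1, hJ2, hJ3⟩ :=
    exists_couplingSpace_weights p hq0.le hq1.le hρ0.le hρ n ⌊α * n⌋₊
  refine ⟨J, hJ, hJ1, hJ2, fun hn m hm ↦ ?_⟩
  -- The distance never exceeds `2 n`, so bounds decaying in `n` also decay in `m`.
  by_cases hmn : m ≤ 2 * n
  swap
  · refine (le_of_eq (Finset.sum_eq_zero fun ω _ ↦ if_neg fun h ↦ hmn ?_)).trans (by positivity)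
    exact h.trans (abs_pRank_sub_le hα.1 hα.2 _ _)
  have hone : ∑ ω : CouplingSpace p n ⌊α * n⌋₊,
      (if m ≤ |(pRank p (SandpileGroup (matrixGraph ω.1)) : ℝ) -
        max ((zeroCount ω.2 : ℝ) - α * n) 0| then J ω else 0) ≤ 1 := by
    calc _ ≤ ∑ ω : CouplingSpace p n ⌊α * n⌋₊, J ω := Finset.sum_le_sum fun ω _ ↦ by
          split_ifs
          · exact le_rfl
          · exact hJ ω
      _ = 1 := by
          rw [sum_couplingSpace]
          simp only [hJ1, sum_matWeight p]
  have hexp : ∀ x : ℝ, c * m ≤ x → Real.exp (-x) ≤ Real.exp (-(c * m)) := fun x hx ↦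
    Real.exp_le_exp.2 (neg_le_neg hx)
  rcases lt_or_ge n N with hnN | hnN
  · have h1 : (1 : ℝ) ≤ Real.exp (c * (2 * N)) * Real.exp (-(c * m)) := by
      rw [← Real.exp_add]
      refine Real.one_le_exp ?_
      have h2 : (n : ℝ) ≤ N := by exact_mod_cast hnN.le
      have h3 : m ≤ 2 * N := by linarith
      nlinarith
    refine (hone.trans h1).trans (mul_le_mul_of_nonneg_right ?_ (by positivity))
    have : 0 ≤ (2 * p + 2) * K₀ + 16 * (p : ℝ) ^ 7 := by positivity
    linarith
  obtain ⟨D, s, hs0, hs1, hD, hτ, hτn, hs⟩ := hN n hnN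
  have hrn : ⌊α * n⌋₊ ≤ n := by
    refine Nat.floor_le_of_le ?_
    have : (0 : ℝ) ≤ n := by positivity
    nlinarith [hα.2]
  have hn1 : (1 : ℝ) ≤ n := by exact_mod_cast hn
  have hB := sum_matWeight_mul_pow_sub_le (p := p) (q := q) (B := 16 * p ^ 6)
    (L := Fin n) (R := Fin ⌊α * n⌋₊) fun d ↦ by
      exact sum_matWeight_mul_pow_finrank_le hq0.le hq1.le hρ0 hρ1 hρ hs0 hs1
        (by rwa [Fintype.card_fin]) (by rwa [Fintype.card_fin, Fintype.card_fin]) hτ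
        (by rwa [Fintype.card_fin]) (by rwa [Fintype.card_fin]) d
  have htail := sum_abs_pRank_sub_ge_le hα.1 hJ hJ1 hB m
  have hconn := sum_matWeight_disconnected_le (L := Fin n) (R := Fin ⌊α * n⌋₊) hq0.le hq1.le
  rw [Fintype.card_fin, Fintype.card_fin] at hconn
  have hnsq : (n : ℝ) ≤ n ^ 2 := by nlinarith
  have hβr : 0 ≤ β ^ ⌊α * n⌋₊ := by positivity
  have h1 : (n : ℝ) ^ 2 * (1 - q ^ 2) ^ ⌊α * n⌋₊ + ⌊α * n⌋₊ * (1 - q) ^ n ≤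
      2 * (n ^ 2 * β ^ ⌊α * n⌋₊) := by
    have e1 : (1 - q ^ 2) ^ ⌊α * n⌋₊ ≤ β ^ ⌊α * n⌋₊ :=
      pow_le_pow_left₀ (by nlinarith) (le_max_right _ _) ⌊α * n⌋₊
    have e2 : (1 - q) ^ n ≤ β ^ ⌊α * n⌋₊ :=
      (pow_le_pow_left₀ (by linarith) (by linarith) n).trans
        ((pow_le_pow_of_le_one (by nlinarith) (by nlinarith) hrn).trans e1)
    have e3 : (⌊α * n⌋₊ : ℝ) ≤ n ^ 2 := le_trans (by exact_mod_cast hrn) hnsq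
    have e4 : (⌊α * n⌋₊ : ℝ) * (1 - q) ^ n ≤ n ^ 2 * β ^ ⌊α * n⌋₊ :=
      mul_le_mul e3 e2 (pow_nonneg (by linarith) _) (by positivity)
    have e5 := mul_le_mul_of_nonneg_left e1 (by positivity : (0 : ℝ) ≤ n ^ 2)
    linarith
  have h2 : (n : ℝ) * (p * ρ ^ ⌊α * n⌋₊) ≤ p * (n ^ 2 * β ^ ⌊α * n⌋₊) := by
    have e1 : ρ ^ ⌊α * n⌋₊ ≤ β ^ ⌊α * n⌋₊ := pow_le_pow_left₀ hρ0.le (le_max_left _ _) ⌊α * n⌋₊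
    have e2 := mul_le_mul hnsq e1 (by positivity) (by positivity)
    nlinarith
  set x := (n : ℝ) * (p * ρ ^ ⌊α * n⌋₊) with hx
  have hx0 : 0 ≤ x := by positivity
  set W := (n : ℝ) ^ 2 * β ^ ⌊α * n⌋₊
  have hW0 : 0 ≤ W := by positivity
  have hlast : (p : ℝ) * Real.exp (-(Real.log p * m)) * (16 * p ^ 6) ≤
      16 * p ^ 7 * Real.exp (-(c * m)) := by
    have := hexp _ (mul_le_mul_of_nonneg_right (min_le_right _ _ : c ≤ Real.log p) hm.le)
    calc _ = 16 * (p : ℝ) ^ 7 * Real.exp (-(Real.log p * m)) := by ring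
      _ ≤ _ := mul_le_mul_of_nonneg_left this (by positivity)
  have hlast0 : 0 ≤ (p : ℝ) * Real.exp (-(Real.log p * m)) * (16 * p ^ 6) := by positivity
  -- `exp x - 1 ≤ 2 x` when `x ≤ 1`, while a probability is at most `1 ≤ 2 x` otherwise.
  have hmain : ∑ ω : CouplingSpace p n ⌊α * n⌋₊,
      (if m ≤ |(pRank p (SandpileGroup (matrixGraph ω.1)) : ℝ) -
        max ((zeroCount ω.2 : ℝ) - α * n) 0| then J ω else 0) ≤
      (2 * p + 2) * W + p * Real.exp (-(Real.log p * m)) * (16 * p ^ 6) := by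
    rcases le_total x 1 with hx1 | hx1
    · have h3 : Real.exp x - 1 ≤ 2 * x := by
        have h4 := Real.abs_exp_sub_one_le (x := x) (by rwa [abs_of_nonneg hx0])
        rw [abs_of_nonneg hx0] at h4
        exact (le_abs_self _).trans h4
      linarith
    · linarith
  refine hmain.trans ?_
  have h3 : (2 * p + 2) * W ≤ (2 * p + 2) * K₀ * Real.exp (-(c * m)) := by
    rw [mul_assoc]
    refine mul_le_mul_of_nonneg_left ((hdecay n).trans ?_) (by positivity)
    refine mul_le_mul_of_nonneg_left (hexp _ ?_) hK₀.le
    calc c * m ≤ c₀ / 2 * (2 * n) :=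
          mul_le_mul (min_le_left _ _) hmn hm.le (by positivity)
      _ = c₀ * n := by ring
  have h4 : 0 ≤ Real.exp (c * (2 * N)) * Real.exp (-(c * m)) := by positivity
  linarith

end tail

/-- The laws of the random graph `G n` and of the binomial variable `B n` are the prescribed ones;
they are realised on a common probability space, where the distance between the `p`-rank and
`max (B n - α n, 0)` makes sense. -/
theorem mainTheorem2 (p : ℕ) [Fact p.Prime] (α : ℝ) (hα : 0 < α ∧ α < 1)
    (q : unitInterval) (hq : 0 < q ∧ q < 1) :
    ∃ (Ω : Type) (_ : MeasurableSpace Ω) (μ : Measure Ω) (_ : IsProbabilityMeasure μ)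
      (G : (n : ℕ) → Ω → SimpleGraph (Fin n ⊕ Fin ⌊α * n⌋₊)) (B : ℕ → Ω → ℕ),
      (∀ n, HasLaw (G n) (randomBipartiteLaw n α q) μ) ∧
      (∀ n, HasLaw (B n) (binomial n (oneDivNat p)) μ) ∧
      UsuallyWithinSmallDistance μ
        (fun n ω ↦ (pRank p (SandpileGroup (G n ω)) : ℝ))
        (fun n ω ↦ max ((B n ω : ℝ) - α * n) 0) := by
  obtain ⟨c, hc, K, hK, h⟩ := exists_tail_bound p hα (q := (q : ℝ)) hq.1 hq.2
  choose J hJ hJ1 hJ2 hJ3 using h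
  have hprob : ∀ n, IsProbabilityMeasure (weightMeasure (J n)) := fun n ↦ by
    refine isProbabilityMeasure_weightMeasure (hJ n) ?_
    rw [sum_couplingSpace]
    simp only [hJ1, sum_matWeight p]
  have heval := fun n ↦ measurePreserving_eval_infinitePi (fun n ↦ weightMeasure (J n)) n
  refine ⟨(n : ℕ) → CouplingSpace p n ⌊α * n⌋₊, inferInstance,
    Measure.infinitePi fun n ↦ weightMeasure (J n), inferInstance,
    fun n ω ↦ matrixGraph (ω n).1, fun n ω ↦ zeroCount (ω n).2, fun n ↦ ?_, fun n ↦ ?_,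
    c, hc, K, hK, fun n hn m hm ↦ ?_⟩
  · refine ⟨((Measurable.of_discrete (f := fun ω : CouplingSpace p n ⌊α * n⌋₊ ↦
      matrixGraph ω.1)).comp (heval n).measurable).aemeasurable, ?_⟩
    rw [← map_weightMeasure_matrixGraph (hJ n) (hJ1 n), ← (heval n).map_eq,
      Measure.map_map Measurable.of_discrete (heval n).measurable]
    rfl
  · refine ⟨((Measurable.of_discrete (f := fun ω : CouplingSpace p n ⌊α * n⌋₊ ↦
      zeroCount ω.2)).comp (heval n).measurable).aemeasurable, ?_⟩
    rw [← map_weightMeasure_zeroCount (hJ n) (hJ2 n), ← (heval n).map_eq,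
      Measure.map_map Measurable.of_discrete (heval n).measurable]
    rfl
  · refine le_trans (le_of_eq ?_) (hJ3 n hn m hm)
    have h1 := (heval n).measureReal_preimage (s := {ω : CouplingSpace p n ⌊α * n⌋₊ |
      m ≤ |(pRank p (SandpileGroup (matrixGraph ω.1)) : ℝ) -
        max ((zeroCount ω.2 : ℝ) - α * n) 0|}) (MeasurableSet.of_discrete).nullMeasurableSet
    rw [weightMeasure_real_apply (hJ n)] at h1
    exact h1
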